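/- Let $d_x,d_y,N$ be positive integers and $1\le p<\infty$. For $\sigma:\mathbb{R}\to\mathbb{R}$ (applied componentwise to vectors) and an integer $d\ge1$, a \emph{BRNN cell of width $d$} is a map $\mathcal{B}:(\mathbb{R}^{d})^N\to(\mathbb{R}^{d})^N$, $z=(z[1],\dots,z[N])\mapsto \mathcal{B}(z)$, of the form $$\mathcal{B}(z)[t]=W\,h[t]+\bar W\,\bar h[t]\qquad(1\le t\le N),$$ $$h[0]=0,\quad h[t]=\sigma\left(A\,h[t-1]+B\,z[t]+\theta\right),\qquad \bar h[N+1]=0,\quad \bar h[t]=\sigma\left(\bar A\,\bar h[t+1]+\bar B\,z[t]+\bar\theta\right),$$ with $A,B,\bar A,\bar B,W,\bar W\in\mathbb{R}^{d\times d}$ and $\theta,\bar\theta\in\mathbb{R}^{d}$. A \emph{deep BRNN of width $d$} with activation $\sigma$ is a map $\mathcal{N}=\mathcal{Q}\circ\mathcal{B}_L\circ\cdots\circ\mathcal{B}_1\circ\mathcal{P}:(\mathbb{R}^{d_x})^N\to(\mathbb{R}^{d_y})^N$ with $L\ge2$, where $\mathcal{B}_1,\dots,\mathcal{B}_L$ are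 BRNN cells of width $d$, $\mathcal{P}(x)[t]=P\,x[t]$ and $\mathcal{Q}(z)[t]=Q\,z[t]$ for matrices $P\in\mathbb{R}^{d\times d_x}$, $Q\in\mathbb{R}^{d_y\times d}$. The activation $\sigma$ is \emph{non-degenerate} if it is continuous, is not a polynomial, and is continuously differentiable at some point $z_0$ with $\sigma'(z_0)\neq0$. \textbf{Theorem.} Let $f\in L^p\left((\mathbb{R}^{d_x})^N,(\mathbb{R}^{d_y})^N\right)$ be any sequence-to-sequence map (not necessarily past-dependent). (1) For every non-degenerate $\sigma$, every $\epsilon>0$ and every compact $K\subset\mathbb{R}^{d_x}$, there is a deep BRNN $\mathcal{N}$ with activation $\sigma$ and width $\max\{d_x+1,d_y\}+1$ such that $$\sup_{1\le t\le N}\left(\int_{K^N}\left\|f(x)[t]-\mathcal{N}(x)[t]\right\|^p\,dx\right)^{1/p}<\epsilon .$$ (2) If $\sigma$ is $\mathrm{ReLU}$, $\mathrm{ReLU}(z)=\max\{z,0\}$, then for every $\epsilon>0$ there is a deep BRNN $\mathcal{N}$ with activation $\mathrm{ReLU}$ and width $\max\{d_x+1,d_y\}$ such that $$\sup_{1\le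 t\le N}\left(\int_{(\mathbb{R}^{d_x})^N}\left\|f(x)[t]-\mathcal{N}(x)[t]\right\|^p\,dx\right)^{1/p}<\epsilon .$$ -/

import Mathlib

open MeasureTheory Filter Topology
open scoped Matrix ENNReal

/-- `ReLU(z) = max(z, 0)`. -/
noncomputable def relu (z : ℝ) : ℝ := max z 0

/-- `z₀` is a non-degenerating point of `σ`: `σ` is continuously differentiable at `z₀`
(it is differentiable near `z₀` and its derivative is continuous at `z₀`), and `σ'(z₀) ≠ 0`. -/
def IsNondegeneratingPoint (σ : ℝ → ℝ) (z₀ : ℝ) : Prop :=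
  (∀ᶠ z in 𝓝 z₀, DifferentiableAt ℝ σ z) ∧ ContinuousAt (deriv σ) z₀ ∧ deriv σ z₀ ≠ 0

/-- Non-degenerate activation functions: continuous, not a polynomial function, with at least one
non-degenerating point. -/
def IsNondegenerate (σ : ℝ → ℝ) : Prop :=
  Continuous σ ∧ (¬ ∃ q : Polynomial ℝ, ∀ z, σ z = q.eval z) ∧ ∃ z₀, IsNondegeneratingPoint σ z₀

/-- The parameters `A`, `B`, `θ` of a recurrent cell on the hidden space `ℝᵈ`. -/
structure RNNCell (d : ℕ) where
  A : Matrix (Fin d) (Fin d) ℝ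
  B : Matrix (Fin d) (Fin d) ℝ
  θ : Fin d → ℝ

namespace RNNCell

/-- The state of a recurrent cell after reading the first `t` tokens of `x`: it starts at the zero
vector, and `state (t + 1) = σ (A (state t) + B x[t + 1] + θ)` with `σ` acting componentwise.
The token `x[t + 1]` (counted from one) is `x ⟨t, _⟩`; the value for `t > N` is irrelevant. -/
noncomputable def state {d N : ℕ} (c : RNNCell d) (σ : ℝ → ℝ) (x : Fin N → Fin d → ℝ) :
    ℕ → Fin d → ℝ
  | 0 => 0
  | t + 1 =>
    if h : t < N then fun i => σ ((c.A *ᵥ c.state σ x t + c.B *ᵥ x ⟨t, h⟩ + c.θ) i) else 0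

/-- The output sequence of a recurrent cell which reads `x` from the first token to the last. -/
noncomputable def forward {d N : ℕ} (c : RNNCell d) (σ : ℝ → ℝ) (x : Fin N → Fin d → ℝ) :
    Fin N → Fin d → ℝ :=
  fun t => c.state σ x (t + 1)

/-- The output sequence of a recurrent cell which reads `x` from the last token to the first;
its output at time `t` depends on `x[t], …, x[N]`. -/
noncomputable def backward {d N : ℕ} (c : RNNCell d) (σ : ℝ → ℝ) (x : Fin N → Fin d → ℝ) :
    Fin N → Fin d → ℝ :=
  fun t => c.forward σ (fun s => x s.rev) t.rev

end RNNCell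

/-- The parameters of a BRNN cell of width `d`: a forward and a backward recurrent cell, and the
two matrices of the token-wise linear map which combines their outputs. -/
structure BRNNCell (d : ℕ) where
  fwd : RNNCell d
  bwd : RNNCell d
  W : Matrix (Fin d) (Fin d) ℝ
  Wbar : Matrix (Fin d) (Fin d) ℝ

/-- The sequence map computed by a BRNN cell. -/
noncomputable def BRNNCell.apply {d N : ℕ} (c : BRNNCell d) (σ : ℝ → ℝ) (x : Fin N → Fin d → ℝ) :
    Fin N → Fin d → ℝ :=
  fun t => c.W *ᵥ c.fwd.forward σ x t + c.Wbar *ᵥ c.bwd.backward σ x t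

/-- The parameters of a bidirectional recurrent network with input dimension `dx`, width `d` and
output dimension `dy`: a lifting matrix, a list of BRNN cells (the first one acts first) and a
projection matrix. -/
structure BRNN (dx d dy : ℕ) where
  P : Matrix (Fin d) (Fin dx) ℝ
  cells : List (BRNNCell d)
  Q : Matrix (Fin dy) (Fin d) ℝ

namespace BRNN

/-- A network is deep if it has at least two cells. -/
def IsDeep {dx d dy : ℕ} (net : BRNN dx d dy) : Prop := 2 ≤ net.cells.length

/-- The map `Q ∘ BR_L ∘ ⋯ ∘ BR_1 ∘ P` computed by the network on sequences of length `N`. -/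
noncomputable def eval {dx d dy : ℕ} (net : BRNN dx d dy) (σ : ℝ → ℝ) {N : ℕ}
    (x : Fin N → EuclideanSpace ℝ (Fin dx)) : Fin N → EuclideanSpace ℝ (Fin dy) :=
  fun t => WithLp.toLp 2
    (net.Q *ᵥ (net.cells.foldl (fun h c => c.apply σ h) (fun s => net.P *ᵥ (x s).ofLp)) t)

end BRNN

/-! A class of sequence maps that stacks of cells approximate uniformly on compact sets is closed
under composition, so a target may be assembled from elementary maps, with depth replacing width.

A cell without recurrence acts on each token separately. Linearising `σ` at a point with nonzero
derivative gives every linear map, and the second half of the cell adds one neuron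
(`approximable_linear_add_neuron`). Shears `z ↦ z + g(a · z) v` with `a · v = 0` compose by adding
their profiles `g`. As translates and dilates of a continuous non-polynomial `σ` span a dense
subspace of `C([-R, R])` (`neuronSpace_eq_top`), every continuous profile is reached
(`IsNondegenerate.approximable_shear`).

For a uniformly continuous target on a box, each token is quantised to a number stored in one spare
coordinate. A single recurrent cell then turns the sequence of these numbers into one scalar per
time, which determines both the time and the whole sequence (`IsNondegenerate.exists_recurrence`).
Only finitely many scalars occur, and `IsNondegenerate.exists_decoder` sends each to the prescribed
output vector within the available coordinates. Width `d` with `dx < d` and `dy ≤ d` therefore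
suffices in both parts. The discontinuous quantiser is replaced by continuous encoders that agree
with it eventually at each interior point, so dominated convergence gives closeness in `Lᵖ`; density
of continuous compactly supported maps finishes part (1).

On the whole space the `relu` network must vanish exactly off a bounded set. Inputs are clipped to
the box, so that outside points land on its boundary. There the encoder has a high peak, the
recurrence becomes large, and the decoder returns zero. A final soft threshold turns the remaining
approximation error into an exact zero. -/

/-! ### Maps approximable by stacks of cells -/

section Approximable

variable {N d : ℕ} {σ : ℝ → ℝ}

/-- The sequence map computed by a stack of cells, the head of the list acting first. -/
noncomputable def runCells (σ : ℝ → ℝ) (l : List (BRNNCell d)) (z : Fin N → Fin d → ℝ) :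
    Fin N → Fin d → ℝ :=
  l.foldl (fun h c => c.apply σ h) z

theorem runCells_append (l l' : List (BRNNCell d)) (z : Fin N → Fin d → ℝ) :
    runCells σ (l ++ l') z = runCells σ l' (runCells σ l z) := by
  simp [runCells, List.foldl_append]

theorem RNNCell.continuous_state (c : RNNCell d) (hσ : Continuous σ) (t : ℕ) :
    Continuous fun x : Fin N → Fin d → ℝ => c.state σ x t := by
  induction t with
  | zero => simpa [RNNCell.state] using continuous_const
  | succ t ih =>
    by_cases h : t < N
    · simp only [RNNCell.state, h, dite_true]
      refine continuous_pi fun i => hσ.comp ?_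
      have h1 : Continuous fun x : Fin N → Fin d → ℝ =>
          c.A *ᵥ c.state σ x t + c.B *ᵥ x ⟨t, h⟩ + c.θ :=
        ((continuous_const.matrix_mulVec ih).add
          (continuous_const.matrix_mulVec (continuous_apply _))).add continuous_const
      exact (continuous_apply i).comp h1
    · simpa [RNNCell.state, h] using continuous_const

theorem BRNNCell.continuous_apply (c : BRNNCell d) (hσ : Continuous σ) :
    Continuous fun x : Fin N → Fin d → ℝ => c.apply σ x := by
  refine continuous_pi fun t => ?_
  simp only [BRNNCell.apply, RNNCell.forward, RNNCell.backward]
  refine (continuous_const.matrix_mulVec (c.fwd.continuous_state hσ _)).add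
    (continuous_const.matrix_mulVec ?_)
  have h : Continuous fun (x : Fin N → Fin d → ℝ) (s : Fin N) => x s.rev :=
    continuous_pi fun s => _root_.continuous_apply s.rev
  exact (c.bwd.continuous_state hσ (t.rev + 1)).comp h

theorem continuous_runCells (hσ : Continuous σ) (l : List (BRNNCell d)) :
    Continuous fun x : Fin N → Fin d → ℝ => runCells σ l x := by
  induction l with
  | nil => exact continuous_id
  | cons c l ih => exact ih.comp (c.continuous_apply hσ)

/-- A continuous sequence map which stacks of at least `n` cells approximate uniformly on compact
sets. -/
def Approximable (σ : ℝ → ℝ) (n : ℕ) (F : (Fin N → Fin d → ℝ) → Fin N → Fin d → ℝ) : Prop :=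
  Continuous F ∧ ∀ K, IsCompact K → ∀ ε : ℝ, 0 < ε →
    ∃ l : List (BRNNCell d), n ≤ l.length ∧ ∀ z ∈ K, dist (runCells σ l z) (F z) ≤ ε

theorem Approximable.mono {m n : ℕ} (h : m ≤ n) {F : (Fin N → Fin d → ℝ) → Fin N → Fin d → ℝ}
    (hF : Approximable σ n F) : Approximable σ m F :=
  ⟨hF.1, fun K hK ε hε => (hF.2 K hK ε hε).imp fun _ hl => ⟨h.trans hl.1, hl.2⟩⟩

theorem Approximable.congr {n : ℕ} {F G : (Fin N → Fin d → ℝ) → Fin N → Fin d → ℝ}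
    (hF : Approximable σ n F) (h : ∀ z, F z = G z) : Approximable σ n G :=
  (funext h : F = G) ▸ hF

theorem Approximable.comp {m n : ℕ} {F G : (Fin N → Fin d → ℝ) → Fin N → Fin d → ℝ}
    (hF : Approximable σ m F) (hG : Approximable σ n G) :
    Approximable σ (n + m) fun z => F (G z) := by
  refine ⟨hF.1.comp hG.1, fun K hK ε hε => ?_⟩
  -- The stack approximating `G` leaves `G '' K`, so `F` has to be controlled on a compact
  -- neighbourhood of it.
  set K' := Metric.cthickening 1 (G '' K)
  have hK' : IsCompact K' := (hK.image hG.1).cthickening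
  have hunif := hK'.uniformContinuousOn_of_continuous hF.1.continuousOn
  obtain ⟨r, hr, hFr⟩ := Metric.uniformContinuousOn_iff_le.1 hunif (ε / 2) (half_pos hε)
  obtain ⟨l, hl, hlG⟩ := hG.2 K hK (min r 1) (lt_min hr one_pos)
  obtain ⟨l', hl', hlF⟩ := hF.2 K' hK' (ε / 2) (half_pos hε)
  refine ⟨l ++ l', by simp; omega, fun z hz => ?_⟩
  have hz1 : runCells σ l z ∈ K' :=
    Metric.mem_cthickening_of_dist_le _ (G z) _ _ (Set.mem_image_of_mem _ hz)
      ((hlG z hz).trans (min_le_right _ _))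
  have hz2 : G z ∈ K' := Metric.self_subset_cthickening _ (Set.mem_image_of_mem _ hz)
  rw [runCells_append]
  calc dist (runCells σ l' (runCells σ l z)) (F (G z))
      ≤ dist (runCells σ l' (runCells σ l z)) (F (runCells σ l z))
        + dist (F (runCells σ l z)) (F (G z)) := dist_triangle _ _ _
    _ ≤ ε / 2 + ε / 2 := add_le_add (hlF _ hz1)
        (hFr _ hz1 _ hz2 ((hlG z hz).trans (min_le_left _ _)))
    _ = ε := add_halves ε

theorem Approximable.of_limit {n : ℕ} {F : (Fin N → Fin d → ℝ) → Fin N → Fin d → ℝ}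
    (hc : Continuous F)
    (hF : ∀ K, IsCompact K → ∀ ε : ℝ, 0 < ε →
      ∃ F', Approximable σ n F' ∧ ∀ z ∈ K, dist (F' z) (F z) ≤ ε) : Approximable σ n F := by
  refine ⟨hc, fun K hK ε hε => ?_⟩
  obtain ⟨F', hF', h⟩ := hF K hK (ε / 2) (half_pos hε)
  obtain ⟨l, hl, hl'⟩ := hF'.2 K hK (ε / 2) (half_pos hε)
  exact ⟨l, hl, fun z hz => (dist_triangle _ _ _).trans
    ((add_le_add (hl' z hz) (h z hz)).trans (add_halves ε).le)⟩

theorem BRNNCell.approximable (hσ : Continuous σ) (c : BRNNCell d) :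
    Approximable (N := N) σ 1 fun z => c.apply σ z :=
  ⟨c.continuous_apply hσ, fun _ _ ε hε => ⟨[c], le_rfl, fun z _ => by
    simpa [runCells] using hε.le⟩⟩

/-- A cell without recurrence acts token by token. -/
theorem BRNNCell.apply_of_A_eq_zero (B B' W W' : Matrix (Fin d) (Fin d) ℝ) (θ θ' : Fin d → ℝ)
    (z : Fin N → Fin d → ℝ) :
    BRNNCell.apply ⟨⟨0, B, θ⟩, ⟨0, B', θ'⟩, W, W'⟩ σ z = fun t =>
      (W *ᵥ fun i => σ ((B *ᵥ z t) i + θ i)) + W' *ᵥ fun i => σ ((B' *ᵥ z t) i + θ' i) := by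
  funext t
  have h : 0 < N := t.pos
  have h' : Fin.rev ⟨N - (t + 1), t.rev.2⟩ = t := Fin.rev_rev t
  simp [BRNNCell.apply, RNNCell.forward, RNNCell.backward, RNNCell.state, h, h']

theorem exists_linearization {z₀ σ' : ℝ} (hσ' : HasDerivAt σ σ' z₀) (h0 : σ' ≠ 0) (R ε : ℝ)
    (hR : 0 < R) (hε : 0 < ε) :
    ∃ δ : ℝ, δ ≠ 0 ∧ ∀ y, |y| ≤ R → |(δ * σ')⁻¹ * (σ (δ * y + z₀) - σ z₀) - y| ≤ ε := by
  have h1 := hasDerivAt_iff_isLittleO_nhds_zero.1 hσ'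
  -- The remainder is at most `c * δ * R` for `|y| ≤ R`; dividing by `δ * |σ'|` leaves `c * R /
  -- |σ'|`, which is `ε` for this `c`.
  have h2 := h1.def (c := |σ'| * ε / R) (by positivity)
  obtain ⟨r, hr, hb⟩ := Metric.eventually_nhds_iff.1 h2
  have hδ : 0 < r / (2 * R) := by positivity
  refine ⟨r / (2 * R), hδ.ne', fun y hy => ?_⟩
  set δ := r / (2 * R)
  have hδy : |δ * y| ≤ δ * R := by rw [abs_mul, abs_of_pos hδ]; gcongr
  have hδR : δ * R = r / 2 := by simp only [δ]; field_simp
  have h3 := hb (y := δ * y) (by rw [Real.dist_eq, sub_zero]; linarith)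
  rw [Real.norm_eq_abs, Real.norm_eq_abs, smul_eq_mul, add_comm z₀] at h3
  have h4 : (δ * σ')⁻¹ * (σ (δ * y + z₀) - σ z₀) - y
      = (δ * σ')⁻¹ * (σ (δ * y + z₀) - σ z₀ - δ * y * σ') := by field_simp
  rw [h4, abs_mul, abs_inv, abs_mul, abs_of_pos hδ]
  calc (δ * |σ'|)⁻¹ * |σ (δ * y + z₀) - σ z₀ - δ * y * σ'|
      ≤ (δ * |σ'|)⁻¹ * (|σ'| * ε / R * (δ * R)) := by gcongr; exact h3.trans (by gcongr)
    _ = ε := by have := abs_pos.2 h0; field_simp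

/-- A token-wise linear map plus one neuron. -/
theorem approximable_linear_add_neuron (hσ : Continuous σ) {z₀ σ' : ℝ}
    (hσ' : HasDerivAt σ σ' z₀) (h0 : σ' ≠ 0) {i₀ i₁ : Fin d} (hi : i₀ ≠ i₁)
    (M : Matrix (Fin d) (Fin d) ℝ) (v a : Fin d → ℝ) (b : ℝ) :
    Approximable (N := N) σ 1 fun z t => M *ᵥ z t + σ (a ⬝ᵥ z t + b) • v := by
  refine Approximable.of_limit ?_ fun K hK ε hε => ?_
  · refine continuous_pi fun t => Continuous.add (f := fun z : Fin N → Fin d → ℝ => M *ᵥ z t)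
      (continuous_const.matrix_mulVec (continuous_apply t)) ?_
    exact (hσ.comp ((continuous_const.dotProduct (continuous_apply t)).add
      continuous_const)).smul continuous_const
  obtain ⟨R, hR⟩ := hK.isBounded.exists_norm_le
  let LM : (Fin d → ℝ) →L[ℝ] (Fin d → ℝ) := LinearMap.toContinuousLinearMap (Matrix.mulVecLin M)
  obtain ⟨δ, hδ, hlin⟩ := exists_linearization hσ' h0 (max R 1) (ε / (‖LM‖ + 1))
    (by positivity) (by positivity)
  -- The forward half linearises `M`. In the backward half coordinate `i₁` is the neuron, while `i₀`
  -- has zero weights and constantly outputs `σ z₀`, which cancels the offset of the linearisation.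
  -- This is why two coordinates are needed.
  let c : BRNNCell d := ⟨⟨0, δ • 1, fun _ => z₀⟩,
    ⟨0, Matrix.of fun i => if i = i₁ then a else 0, fun i => if i = i₁ then b else z₀⟩,
    (δ * σ')⁻¹ • M,
    Matrix.of fun i j => if j = i₁ then v i else if j = i₀ then
      -((δ * σ')⁻¹ * (M *ᵥ fun _ => 1) i) else 0⟩
  have hc : ∀ z : Fin N → Fin d → ℝ, c.apply σ z = fun t =>
      (M *ᵥ fun i => (δ * σ')⁻¹ * (σ (δ * z t i + z₀) - σ z₀)) + σ (a ⬝ᵥ z t + b) • v := by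
    intro z
    rw [BRNNCell.apply_of_A_eq_zero]
    funext t i
    have e1 : ∀ j : Fin d, ((if j = i₁ then v i else if j = i₀ then
        -((δ * σ')⁻¹ * (M *ᵥ fun _ => 1) i) else 0) *
          σ (((Matrix.of fun i => if i = i₁ then a else 0) *ᵥ z t) j +
            if j = i₁ then b else z₀)) =
        (if j = i₁ then v i * σ (a ⬝ᵥ z t + b) else 0) +
        (if j = i₀ then -((δ * σ')⁻¹ * (M *ᵥ fun _ => 1) i) * σ z₀ else 0) := by
      intro j
      by_cases h1 : j = i₁
      · subst h1; simp [Matrix.mulVec, Ne.symm hi]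
      · by_cases h2 : j = i₀ <;> simp [h1, h2, hi, Matrix.mulVec]
    have e2 : ((Matrix.of fun i j => if j = i₁ then v i else if j = i₀ then
        -((δ * σ')⁻¹ * (M *ᵥ fun _ => 1) i) else 0) *ᵥ fun j =>
          σ (((Matrix.of fun i => if i = i₁ then a else 0) *ᵥ z t) j +
            if j = i₁ then b else z₀)) i =
        v i * σ (a ⬝ᵥ z t + b) - (δ * σ')⁻¹ * (M *ᵥ fun _ => 1) i * σ z₀ := by
      simp only [Matrix.mulVec, dotProduct, Matrix.of_apply] at e1 ⊢
      simp only [e1, Finset.sum_add_distrib, Finset.sum_ite_eq', Finset.mem_univ, if_true]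
      ring
    rw [Pi.add_apply, e2, Pi.add_apply]
    simp only [Matrix.smul_mulVec, Matrix.one_mulVec, Pi.smul_apply, smul_eq_mul]
    simp only [Matrix.mulVec, dotProduct, mul_sub, Finset.sum_sub_distrib, Finset.mul_sum,
      Finset.sum_mul]
    have e3 : ∀ x, M i x * ((δ * σ')⁻¹ * σ (δ * z t x + z₀)) =
      (δ * σ')⁻¹ * (M i x * σ (δ * z t x + z₀)) := fun x => by ring
    have e4 : ∀ x, M i x * ((δ * σ')⁻¹ * σ z₀) = (δ * σ')⁻¹ * (M i x * 1) * σ z₀ :=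
      fun x => by ring
    simp only [e3, e4]
    ring
  refine ⟨fun z => c.apply σ z, c.approximable hσ, fun z hz => ?_⟩
  simp only [hc]
  refine (dist_pi_le_iff hε.le).2 fun t => ?_
  rw [dist_add_right]
  have h5 : dist (fun i => (δ * σ')⁻¹ * (σ (δ * z t i + z₀) - σ z₀)) (z t) ≤ ε / (‖LM‖ + 1) := by
    refine (dist_pi_le_iff (by positivity)).2 fun i => ?_
    refine hlin _ ?_
    exact ((norm_le_pi_norm (z t) i).trans (norm_le_pi_norm z t)).trans
      ((hR z hz).trans (le_max_left _ _))
  have h6 := LM.lipschitz.dist_le_mul (fun i => (δ * σ')⁻¹ * (σ (δ * z t i + z₀) - σ z₀)) (z t)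
  calc _ ≤ ‖LM‖ * (ε / (‖LM‖ + 1)) := h6.trans (by simp only [coe_nnnorm]; gcongr)
    _ ≤ (‖LM‖ + 1) * (ε / (‖LM‖ + 1)) := by gcongr; linarith
    _ = ε := by field_simp

theorem approximable_linear (hσ : Continuous σ) {z₀ σ' : ℝ}
    (hσ' : HasDerivAt σ σ' z₀) (h0 : σ' ≠ 0) {i₀ i₁ : Fin d} (hi : i₀ ≠ i₁)
    (M : Matrix (Fin d) (Fin d) ℝ) :
    Approximable (N := N) σ 1 fun z t => M *ᵥ z t := by
  simpa using approximable_linear_add_neuron (N := N) hσ hσ' h0 hi M 0 0 0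

theorem approximable_id (hσ : Continuous σ) {z₀ σ' : ℝ}
    (hσ' : HasDerivAt σ σ' z₀) (h0 : σ' ≠ 0) {i₀ i₁ : Fin d} (hi : i₀ ≠ i₁) :
    Approximable (N := N) σ 1 fun z : Fin N → Fin d → ℝ => z := by
  simpa using approximable_linear (N := N) hσ hσ' h0 hi 1

end Approximable

/-! ### Density of ridge sums of a continuous non-polynomial function of one variable -/

section RidgeDensity

open Polynomial
open scoped ContDiff Convolution

/-- The closed span of the dilates and translates of `σ` in `C([-R, R])`. -/
noncomputable def neuronSpace (σ : ℝ → ℝ) (R : ℝ) : Submodule ℝ C(Set.Icc (-R) R, ℝ) :=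
  (Submodule.span ℝ {φ | ∃ a b : ℝ, ∀ s : Set.Icc (-R) R, φ s = σ (a * s + b)}).topologicalClosure

theorem Submodule.integral_mem_of_isClosed {E : Type*} [NormedAddCommGroup E] [NormedSpace ℝ E]
    [CompleteSpace E] {V : Submodule ℝ E} (hV : IsClosed (V : Set E)) {H : ℝ → E}
    (hH : Continuous H) (hc : HasCompactSupport H) (hm : ∀ y, H y ∈ V) : ∫ y, H y ∈ V := by
  have : CompleteSpace V := hV.completeSpace_coe
  let H' : ℝ → V := fun y => ⟨H y, hm y⟩
  have h1 : Continuous H' := hH.subtype_mk hm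
  have h2 : HasCompactSupport H' := by
    refine hc.mono fun y hy => ?_
    simpa [H', Subtype.ext_iff] using hy
  have h3 := V.subtypeL.integral_comp_comm (h1.integrable_of_hasCompactSupport h2 (μ := volume))
  have h4 : ∫ y, H y = V.subtypeL (∫ y, H' y) := h3
  rw [h4]
  exact (∫ y, H' y).2

/-- The convolution is the integral of `ψ y • σ (a s + b - y)` over `y`, taken in `C([-R, R])`; its
integrand is a continuous compactly supported curve inside a closed subspace. -/
theorem exists_mem_neuronSpace_convolution {σ : ℝ → ℝ} (hσ : Continuous σ) (R : ℝ)
    {ψ : ℝ → ℝ} (hψ : Continuous ψ) (hc : HasCompactSupport ψ) (a b : ℝ) :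
    ∃ φ ∈ neuronSpace σ R, ∀ s,
      φ s = (ψ ⋆[ContinuousLinearMap.lsmul ℝ ℝ, volume] σ) (a * s + b) := by
  let T : C(ℝ × Set.Icc (-R) R, ℝ) := ⟨fun q => σ (a * q.2 + b - q.1), by fun_prop⟩
  let H : ℝ → C(Set.Icc (-R) R, ℝ) := fun y => ψ y • T.curry y
  have hH : Continuous H := hψ.smul T.curry.continuous
  have hHc : HasCompactSupport H := hc.smul_right
  have hm : ∀ y, H y ∈ neuronSpace σ R := fun y =>
    Submodule.smul_mem _ _ (Submodule.le_topologicalClosure _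
      (Submodule.subset_span ⟨a, b - y, fun s => by simp [T, add_sub_assoc]⟩))
  refine ⟨∫ y, H y, Submodule.integral_mem_of_isClosed
    (Submodule.isClosed_topologicalClosure _) hH hHc hm, fun s => ?_⟩
  have h1 := (ContinuousMap.evalCLM ℝ s : C(Set.Icc (-R) R, ℝ) →L[ℝ] ℝ).integral_comp_comm
    (hH.integrable_of_hasCompactSupport hHc (μ := volume))
  have h2 : (∫ y, H y) s = ∫ y, (H y) s := h1.symm
  rw [h2]
  rfl

/-- Differentiating in the weight `a` produces a factor `s`. Difference quotients converge in the
sup norm because the increment is the integral of a continuous curve in `C([-R, R])`. -/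
theorem exists_mem_mul_deriv {R : ℝ} {V : Submodule ℝ C(Set.Icc (-R) R, ℝ)}
    (hV : IsClosed (V : Set C(Set.Icc (-R) R, ℝ))) {F : ℝ → ℝ} (hF : ContDiff ℝ 1 F) (j : ℕ)
    (h : ∀ a b : ℝ, ∃ φ ∈ V, ∀ s, φ s = (s : ℝ) ^ j * F (a * s + b)) (a b : ℝ) :
    ∃ φ ∈ V, ∀ s, φ s = (s : ℝ) ^ (j + 1) * deriv F (a * s + b) := by
  have hd : Continuous (deriv F) := hF.continuous_deriv le_rfl
  let T : C(ℝ × Set.Icc (-R) R, ℝ) :=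
    ⟨fun q => (q.2 : ℝ) ^ (j + 1) * deriv F ((a + q.1) * q.2 + b), by fun_prop⟩
  have hT : Continuous fun t => T.curry t := T.curry.continuous
  have hI : ∀ t : ℝ, ∀ s : Set.Icc (-R) R, (∫ r in (0 : ℝ)..t, T.curry r) s =
      (s : ℝ) ^ j * F ((a + t) * s + b) - (s : ℝ) ^ j * F (a * s + b) := by
    intro t s
    have h1 := (ContinuousMap.evalCLM ℝ s : C(Set.Icc (-R) R, ℝ) →L[ℝ] ℝ).intervalIntegral_comp_comm
      (hT.intervalIntegrable (μ := volume) 0 t)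
    have h2 : (∫ r in (0 : ℝ)..t, T.curry r) s = ∫ r in (0 : ℝ)..t, (T.curry r) s := h1.symm
    rw [h2, intervalIntegral.integral_eq_sub_of_hasDerivAt
      (f := fun r => (s : ℝ) ^ j * F ((a + r) * s + b))]
    · simp
    · intro r _
      have h3 : HasDerivAt (fun r : ℝ => (a + r) * s + b) (s : ℝ) r := by
        simpa using (((hasDerivAt_id r).const_add a).mul_const (s : ℝ)).add_const b
      have h4 := (((hF.differentiable one_ne_zero).differentiableAt.hasDerivAt).comp r h3).const_mul
        ((s : ℝ) ^ j)
      have h5 : T.curry r s = (s : ℝ) ^ j * (deriv F ((a + r) * s + b) * s) := by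
        change (s : ℝ) ^ (j + 1) * deriv F ((a + r) * s + b) = _
        ring
      rw [h5]
      exact h4
    · exact ((T.continuous.comp (by fun_prop : Continuous fun r : ℝ => (r, s)))).intervalIntegrable _ _
  have hD : HasDerivAt (fun t => ∫ r in (0 : ℝ)..t, T.curry r) (T.curry 0) 0 :=
    intervalIntegral.integral_hasDerivAt_right (hT.intervalIntegrable _ _)
      hT.stronglyMeasurable.stronglyMeasurableAtFilter hT.continuousAt
  have hm : ∀ t, (∫ r in (0 : ℝ)..t, T.curry r) ∈ V := by
    intro t
    obtain ⟨φ, hφ, hφs⟩ := h (a + t) b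
    obtain ⟨φ', hφ', hφs'⟩ := h a b
    convert V.sub_mem hφ hφ' using 1
    ext s
    rw [hI, ContinuousMap.sub_apply, hφs, hφs']
  refine ⟨T.curry 0, ?_, fun s => by simp [T]⟩
  have hlim := hD.tendsto_slope_zero_right
  refine hV.mem_of_tendsto hlim (Eventually.of_forall fun t => ?_)
  exact V.smul_mem _ (V.sub_mem (hm _) (hm _))

theorem exists_mem_pow_mul_iteratedDeriv {R : ℝ} {V : Submodule ℝ C(Set.Icc (-R) R, ℝ)}
    (hV : IsClosed (V : Set C(Set.Icc (-R) R, ℝ))) {F : ℝ → ℝ} (hF : ContDiff ℝ ∞ F)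
    (h : ∀ a b : ℝ, ∃ φ ∈ V, ∀ s, φ s = F (a * s + b)) (j : ℕ) (a b : ℝ) :
    ∃ φ ∈ V, ∀ s, φ s = (s : ℝ) ^ j * iteratedDeriv j F (a * s + b) := by
  induction j generalizing a b with
  | zero => simpa using h a b
  | succ j ih =>
    rw [iteratedDeriv_succ]
    refine exists_mem_mul_deriv hV ?_ j ih a b
    exact ContDiff.iterate_deriv' 1 j (hF.of_le (by exact_mod_cast le_top)) |> fun h => by
      simpa [iteratedDeriv_eq_iterate] using h

theorem exists_polynomial_of_iteratedDeriv_eq_zero {F : ℝ → ℝ} (hF : ContDiff ℝ ∞ F) {k : ℕ}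
    (h : ∀ b, iteratedDeriv k F b = 0) :
    ∃ q : ℝ[X], q.degree < (k + 1 : ℕ) ∧ ∀ s, F s = q.eval s := by
  -- The Lagrange remainder after the term of degree `k` contains the derivative of order `k + 1`.
  have h' : ∀ b, iteratedDeriv (k + 1) F b = 0 := by
    intro b
    have : iteratedDeriv k F = fun _ => 0 := funext h
    rw [iteratedDeriv_succ, this]; simp
  refine ⟨∑ i ∈ Finset.range (k + 1), C ((i.factorial : ℝ)⁻¹ * iteratedDeriv i F 0) * X ^ i,
    ?_, fun s => ?_⟩
  · rw [← mem_degreeLT]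
    refine Submodule.sum_mem _ fun i hi => mem_degreeLT.2 ((degree_C_mul_X_pow_le _ _).trans_lt ?_)
    exact_mod_cast Finset.mem_range.1 hi
  · simp only [eval_finsetSum, eval_mul, eval_C, eval_pow, eval_X]
    rcases eq_or_ne 0 s with rfl | hs
    · rw [Finset.sum_eq_single 0] <;> simp +contextual
    obtain ⟨x', -, hx'⟩ := taylor_mean_remainder_lagrange_iteratedDeriv (n := k) hs
      (hF.of_le (by exact_mod_cast le_top)).contDiffOn
    rw [h', taylor_within_apply] at hx'
    rw [zero_mul, zero_div, sub_eq_zero] at hx'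
    rw [hx']
    refine Finset.sum_congr rfl fun i _ => ?_
    rw [iteratedDerivWithin_eq_iteratedDeriv (uniqueDiffOn_uIcc hs)
      (hF.of_le (by exact_mod_cast le_top)).contDiffAt Set.left_mem_uIcc]
    simp; ring

/-- A polynomial of degree below `k` is a fixed linear expression in its values at `k` nodes, and
such an expression passes to pointwise limits. -/
theorem exists_polynomial_of_tendsto {F : ℕ → ℝ → ℝ} {σ : ℝ → ℝ} {k : ℕ}
    (hF : ∀ n, ∃ q : ℝ[X], q.degree < k ∧ ∀ s, F n s = q.eval s)
    (h : ∀ s, Tendsto (fun n => F n s) atTop (𝓝 (σ s))) : ∃ q : ℝ[X], ∀ s, σ s = q.eval s := by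
  have hinj : Set.InjOn (fun i : ℕ => (i : ℝ)) (Finset.range k : Set ℕ) :=
    Nat.cast_injective.injOn
  refine ⟨Lagrange.interpolate (Finset.range k) (fun i : ℕ => (i : ℝ)) fun i => σ i, fun s => ?_⟩
  refine tendsto_nhds_unique (h s) ?_
  have h1 : ∀ n, F n s = ∑ i ∈ Finset.range k,
      F n i * (Lagrange.basis (Finset.range k) (fun i : ℕ => (i : ℝ)) i).eval s := by
    intro n
    obtain ⟨q, hq, hqs⟩ := hF n
    have := Lagrange.eq_interpolate hinj (f := q) (by simpa using hq)
    rw [hqs]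
    conv_lhs => rw [this]
    simp [Lagrange.interpolate_apply, eval_finsetSum, hqs]
  simp only [h1, Lagrange.interpolate_apply, eval_finsetSum, eval_mul, eval_C]
  exact tendsto_finsetSum _ fun i _ => (h i).mul_const _

/-- Mollify `σ`. If some mollification has a nonzero `k`-th derivative at `b`, weight `a = 0` turns
`s ^ k * F⁽ᵏ⁾(a s + b)` into a nonzero multiple of `s ^ k`. Otherwise all mollifications are
polynomials of bounded degree, and so is their limit `σ`. -/
theorem exists_mem_neuronSpace_pow {σ : ℝ → ℝ} (hσ : Continuous σ)
    (hp : ¬ ∃ q : ℝ[X], ∀ z, σ z = q.eval z) (R : ℝ) (k : ℕ) :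
    ∃ φ ∈ neuronSpace σ R, ∀ s, φ s = (s : ℝ) ^ k := by
  let B : ℕ → ContDiffBump (0 : ℝ) := fun n =>
    ⟨1 / (n + 1) / 2, 1 / (n + 1), by positivity, half_lt_self (by positivity)⟩
  let F : ℕ → ℝ → ℝ := fun n => (B n).normed volume ⋆[ContinuousLinearMap.lsmul ℝ ℝ, volume] σ
  have hF : ∀ n, ContDiff ℝ ∞ (F n) := fun n =>
    (B n).hasCompactSupport_normed.contDiff_convolution_left _ (B n).contDiff_normed
      hσ.locallyIntegrable
  have hV : IsClosed (neuronSpace σ R : Set C(Set.Icc (-R) R, ℝ)) :=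
    Submodule.isClosed_topologicalClosure _
  by_cases h : ∃ n b, iteratedDeriv k (F n) b ≠ 0
  · obtain ⟨n, b, hb⟩ := h
    obtain ⟨φ, hφ, hφs⟩ := exists_mem_pow_mul_iteratedDeriv hV (hF n)
      (exists_mem_neuronSpace_convolution hσ R (B n).continuous_normed
        (B n).hasCompactSupport_normed) k 0 b
    refine ⟨(iteratedDeriv k (F n) b)⁻¹ • φ, Submodule.smul_mem _ _ hφ, fun s => ?_⟩
    simp [hφs]; field_simp
  · push Not at h
    refine absurd (exists_polynomial_of_tendsto
      (fun n => exists_polynomial_of_iteratedDeriv_eq_zero (hF n) (h n)) fun s => ?_) hp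
    exact ContDiffBump.convolution_tendsto_right_of_continuous
      tendsto_one_div_add_atTop_nhds_zero_nat hσ s

theorem neuronSpace_eq_top {σ : ℝ → ℝ} (hσ : Continuous σ)
    (hp : ¬ ∃ q : ℝ[X], ∀ z, σ z = q.eval z) (R : ℝ) : neuronSpace σ R = ⊤ := by
  have h1 : ∀ φ ∈ polynomialFunctions (Set.Icc (-R) R), φ ∈ neuronSpace σ R := by
    intro φ hφ
    obtain ⟨q, -, rfl⟩ := hφ
    choose m hm hms using exists_mem_neuronSpace_pow hσ hp R
    have : Polynomial.toContinuousMapOnAlgHom (Set.Icc (-R) R) q =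
        ∑ i ∈ Finset.range (q.natDegree + 1), q.coeff i • m i := by
      ext s
      simp [hms, ContinuousMap.sum_apply, eval_eq_sum_range]
    change Polynomial.toContinuousMapOnAlgHom (Set.Icc (-R) R) q ∈ _
    rw [this]
    exact Submodule.sum_mem _ fun i _ => Submodule.smul_mem _ _ (hm i)
  refine top_unique fun φ _ => ?_
  have h2 : φ ∈ (polynomialFunctions (Set.Icc (-R) R)).topologicalClosure := by
    rw [polynomialFunctions_closure_eq_top]; trivial
  exact closure_minimal h1 (Submodule.isClosed_topologicalClosure _) h2

end RidgeDensity

/-! ### Token-wise linear maps and shears -/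

section Shears

variable {N d : ℕ} {σ : ℝ → ℝ} {i₀ i₁ : Fin d}

theorem IsNondegenerate.exists_hasDerivAt (hσ : IsNondegenerate σ) :
    ∃ z₀ σ', HasDerivAt σ σ' z₀ ∧ σ' ≠ 0 := by
  obtain ⟨-, -, z₀, h1, -, h3⟩ := hσ
  exact ⟨z₀, _, h1.self_of_nhds.hasDerivAt, h3⟩

theorem IsNondegenerate.approximable_linear (hσ : IsNondegenerate σ) (hi : i₀ ≠ i₁)
    (M : Matrix (Fin d) (Fin d) ℝ) : Approximable (N := N) σ 1 fun z t => M *ᵥ z t := by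
  obtain ⟨z₀, σ', h, h0⟩ := hσ.exists_hasDerivAt
  exact _root_.approximable_linear hσ.1 h h0 hi M

theorem IsNondegenerate.approximable_id (hσ : IsNondegenerate σ) (hi : i₀ ≠ i₁) :
    Approximable σ 1 fun z : Fin N → Fin d → ℝ => z := by
  obtain ⟨z₀, σ', h, h0⟩ := hσ.exists_hasDerivAt
  exact _root_.approximable_id hσ.1 h h0 hi

/-- The token-wise map `z ↦ z + g(a · z) v`. -/
def shear (a v : Fin d → ℝ) (g : ℝ → ℝ) (z : Fin N → Fin d → ℝ) : Fin N → Fin d → ℝ :=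
  fun t => z t + g (a ⬝ᵥ z t) • v

/-- Since `a · v = 0`, the first shear does not change the argument seen by the second. -/
theorem shear_shear {a v : Fin d → ℝ} (h : a ⬝ᵥ v = 0) (g g' : ℝ → ℝ) (z : Fin N → Fin d → ℝ) :
    shear a v g (shear a v g' z) = shear a v (fun s => g' s + g s) z := by
  funext t
  simp [shear, dotProduct_add, h, add_smul, add_assoc]

theorem continuous_shear (a v : Fin d → ℝ) {g : ℝ → ℝ} (hg : Continuous g) :
    Continuous (shear a v g : (Fin N → Fin d → ℝ) → _) := by
  refine continuous_pi fun t => (continuous_apply t).add ?_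
  exact (hg.comp (continuous_const.dotProduct (continuous_apply t))).smul continuous_const

/-- Sums of neurons become compositions of shears. Quantifying over the factor `c` carries the
induction through scalar multiples. -/
theorem exists_approximable_shear_of_mem_span (hσ : IsNondegenerate σ) (hi : i₀ ≠ i₁)
    {a v : Fin d → ℝ} (hav : a ⬝ᵥ v = 0) {R : ℝ} {φ : C(Set.Icc (-R) R, ℝ)}
    (hφ : φ ∈ Submodule.span ℝ
      {φ : C(Set.Icc (-R) R, ℝ) | ∃ a b : ℝ, ∀ s : Set.Icc (-R) R, φ s = σ (a * s + b)}) :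
    ∃ h : ℝ → ℝ, (∀ c : ℝ, Approximable (N := N) σ 0 (shear a v fun s => c * h s)) ∧
      ∀ s : Set.Icc (-R) R, φ s = h s := by
  have hid : Approximable σ 0 fun z : Fin N → Fin d → ℝ => z :=
    (hσ.approximable_id hi).mono zero_le_one
  induction hφ using Submodule.span_induction with
  | mem φ hφ =>
    obtain ⟨α, β, h⟩ := hφ
    refine ⟨fun s => σ (α * s + β), fun c => ?_, h⟩
    obtain ⟨z₀, σ', h', h0⟩ := hσ.exists_hasDerivAt
    refine ((approximable_linear_add_neuron hσ.1 h' h0 hi 1 (c • v) (α • a) β).mono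
      zero_le_one).congr ?_
    intro z
    funext t
    simp [shear, smul_smul, mul_comm]
  | zero =>
    refine ⟨0, fun c => hid.congr fun z => ?_, fun s => rfl⟩
    funext t
    simp [shear]
  | add φ ψ _ _ h1 h2 =>
    obtain ⟨h, hh, hφ⟩ := h1
    obtain ⟨h', hh', hψ⟩ := h2
    refine ⟨fun s => h s + h' s, fun c => ((hh' c).comp (hh c)).congr fun z => ?_, fun s => by
      simp [hφ, hψ]⟩
    rw [shear_shear hav]
    simp only [mul_add]
  | smul c φ _ h1 =>
    obtain ⟨h, hh, hφ⟩ := h1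
    refine ⟨fun s => c * h s, fun c' => (hh (c' * c)).congr fun z => ?_, fun s => by simp [hφ]⟩
    simp only [mul_assoc]

theorem IsNondegenerate.approximable_shear (hσ : IsNondegenerate σ) (hi : i₀ ≠ i₁)
    {a v : Fin d → ℝ} (hav : a ⬝ᵥ v = 0) {g : ℝ → ℝ} (hg : Continuous g) :
    Approximable (N := N) σ 0 (shear a v g) := by
  refine Approximable.of_limit (continuous_shear a v hg) fun K hK ε hε => ?_
  have hc : Continuous fun (z : Fin N → Fin d → ℝ) t => a ⬝ᵥ z t :=
    continuous_pi fun t => continuous_const.dotProduct (continuous_apply t)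
  obtain ⟨R, hR⟩ := (hK.image hc).isBounded.exists_norm_le
  have hR' : ∀ z ∈ K, ∀ t, a ⬝ᵥ z t ∈ Set.Icc (-R) R := fun z hz t =>
    abs_le.1 ((norm_le_pi_norm (fun t => a ⬝ᵥ z t) t).trans
      (hR _ (Set.mem_image_of_mem _ hz)))
  let G : C(Set.Icc (-R) R, ℝ) := ⟨fun s => g s, by fun_prop⟩
  have hG : G ∈ neuronSpace σ R := by rw [neuronSpace_eq_top hσ.1 hσ.2.1]; trivial
  obtain ⟨φ, hφ, hd⟩ := Metric.mem_closure_iff.1 hG (ε / (‖v‖ + 1)) (by positivity)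
  obtain ⟨h, hh, hφh⟩ := exists_approximable_shear_of_mem_span (N := N) hσ hi hav hφ
  refine ⟨_, hh 1, fun z hz => (dist_pi_le_iff hε.le).2 fun t => ?_⟩
  have h1 := (ContinuousMap.dist_apply_le_dist (f := G) (g := φ) ⟨_, hR' z hz t⟩).trans hd.le
  rw [hφh, dist_comm] at h1
  simp only [shear, one_mul, dist_add_left]
  rw [dist_eq_norm, ← sub_smul, norm_smul]
  calc _ ≤ ε / (‖v‖ + 1) * ‖v‖ := by gcongr; exact h1
    _ ≤ ε / (‖v‖ + 1) * (‖v‖ + 1) := by gcongr; linarith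
    _ = ε := by field_simp

/-- Shears along directions which none of the arguments sees can be added up. -/
theorem IsNondegenerate.approximable_sum_shear (hσ : IsNondegenerate σ) (hi : i₀ ≠ i₁)
    {ι : Type*} (S : Finset ι) {a v : ι → Fin d → ℝ}
    (hav : ∀ i ∈ S, ∀ j ∈ S, a i ⬝ᵥ v j = 0) {g : ι → ℝ → ℝ} (hg : ∀ i ∈ S, Continuous (g i)) :
    Approximable (N := N) σ 0 fun z t => z t + ∑ i ∈ S, g i (a i ⬝ᵥ z t) • v i := by
  classical
  induction S using Finset.induction_on with
  | empty => simpa using (hσ.approximable_id hi).mono zero_le_one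
  | insert j S hj ih =>
    have h1 := hσ.approximable_shear (N := N) hi
      (hav j (Finset.mem_insert_self j S) j (Finset.mem_insert_self j S))
      (hg j (Finset.mem_insert_self j S))
    have h2 := ih (fun i hi k hk => hav i (Finset.mem_insert_of_mem hi) k
      (Finset.mem_insert_of_mem hk)) fun i hi => hg i (Finset.mem_insert_of_mem hi)
    refine (h1.comp h2).congr fun z => ?_
    funext t
    have h3 : a j ⬝ᵥ ∑ i ∈ S, g i (a i ⬝ᵥ z t) • v i = 0 := by
      rw [dotProduct_sum]
      refine Finset.sum_eq_zero fun i hi => ?_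
      rw [dotProduct_smul, hav j (Finset.mem_insert_self j S) i (Finset.mem_insert_of_mem hi),
        smul_zero]
    simp only [shear, dotProduct_add, h3, add_zero, Finset.sum_insert hj]
    abel

end Shears

/-! ### Recurrent cells which encode a sequence injectively into each token -/

section Recurrence

variable {N d : ℕ} {σ : ℝ → ℝ}

/-- A collision of two distinct vectors makes `α` a root of a nonzero polynomial, and finitely many
pairs exclude finitely many `α`. The bound `1 ≤ α` ensures later that a weighted sum of nonnegative
terms dominates each term. -/
theorem exists_injOn_sum_pow_mul {n : ℕ} {S : Set (Fin n → ℝ)} (hS : S.Finite) :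
    ∃ α : ℝ, 1 ≤ α ∧ Set.InjOn (fun v : Fin n → ℝ => ∑ i : Fin n, α ^ (i : ℕ) * v i) S := by
  classical
  let q : (Fin n → ℝ) × (Fin n → ℝ) → Polynomial ℝ := fun p =>
    ∑ i : Fin n, Polynomial.C (p.1 i - p.2 i) * Polynomial.X ^ (i : ℕ)
  have hq : ∀ p ∈ hS.toFinset.offDiag, q p ≠ 0 := by
    intro p hp h0
    refine (Finset.mem_offDiag.1 hp).2.2 (funext fun i => ?_)
    have h1 : (q p).coeff i = p.1 i - p.2 i := by
      simp only [q, Polynomial.finsetSum_coeff, Polynomial.coeff_C_mul_X_pow]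
      rw [Finset.sum_eq_single i] <;> simp +contextual [Fin.val_inj, eq_comm]
    rw [h0, Polynomial.coeff_zero] at h1
    linarith
  have hne : ∏ p ∈ hS.toFinset.offDiag, q p ≠ 0 := Finset.prod_ne_zero_iff.2 hq
  obtain ⟨α, hα, hαq⟩ : ∃ α ∈ Set.Ici (1 : ℝ), (∏ p ∈ hS.toFinset.offDiag, q p).eval α ≠ 0 := by
    by_contra! h
    exact hne (Polynomial.eq_zero_of_infinite_isRoot _ ((Set.Ici_infinite 1).mono h))
  refine ⟨α, hα, fun v hv w hw hvw => ?_⟩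
  by_contra hne'
  rw [Polynomial.eval_prod, Finset.prod_ne_zero_iff] at hαq
  refine hαq (v, w) (by simp [hv, hw, hne']) ?_
  simp only [q, Polynomial.eval_finsetSum, Polynomial.eval_mul, Polynomial.eval_C,
    Polynomial.eval_pow, Polynomial.eval_X, sub_mul, Finset.sum_sub_distrib]
  simp only [mul_comm (α ^ _)] at hvw
  exact sub_eq_zero.2 hvw

/-- The state of a scalar recurrence `h[t + 1] = σ (η h[t] + δ b[t] + θ)`, `h[0] = 0`. -/
noncomputable def scalarState (σ : ℝ → ℝ) (η δ θ : ℝ) (b : ℕ → ℝ) : ℕ → ℝ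
  | 0 => 0
  | t + 1 => σ (η * scalarState σ η δ θ b t + δ * b t + θ)

/-- A finite sequence continued by zeros. -/
noncomputable def zeroExtend (b : Fin N → ℝ) (s : ℕ) : ℝ := if h : s < N then b ⟨s, h⟩ else 0

@[simp] theorem zeroExtend_fin (b : Fin N → ℝ) (s : Fin N) : zeroExtend b s = b s := by
  simp [zeroExtend]

/-- The sum of a forward and a multiple of a backward scalar recurrence. -/
noncomputable def scalarRecurrence (σ : ℝ → ℝ) (η δ θ ρ : ℝ) (b : Fin N → ℝ) (t : Fin N) : ℝ :=
  scalarState σ η δ θ (zeroExtend b) (t + 1) +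
    ρ * scalarState σ η δ θ (zeroExtend fun s => b s.rev) (t.rev + 1)

theorem continuous_scalarState (hσ : Continuous σ) (η δ θ : ℝ) (t : ℕ) :
    Continuous fun b : Fin N → ℝ => scalarState σ η δ θ (zeroExtend b) t := by
  induction t with
  | zero => exact continuous_const
  | succ t ih =>
    have h1 : Continuous fun b : Fin N → ℝ => zeroExtend b t := by
      by_cases h : t < N
      · simpa [zeroExtend, h] using continuous_apply (⟨t, h⟩ : Fin N)
      · simpa [zeroExtend, h] using continuous_const
    exact hσ.comp (((continuous_const.mul ih).add (continuous_const.mul h1)).add continuous_const)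

theorem continuous_scalarRecurrence (hσ : Continuous σ) (η δ θ ρ : ℝ) :
    Continuous fun b : Fin N → ℝ => scalarRecurrence σ η δ θ ρ b := by
  refine continuous_pi fun t => (continuous_scalarState hσ η δ θ _).add (continuous_const.mul ?_)
  have h : Continuous fun (b : Fin N → ℝ) (s : Fin N) => b s.rev :=
    continuous_pi fun s => continuous_apply s.rev
  exact (continuous_scalarState hσ η δ θ (t.rev + 1)).comp h

theorem state_single_apply (η δ θ : ℝ) (i₀ j : Fin d) (x : Fin N → Fin d → ℝ) {t : ℕ}
    (ht : t ≤ N) :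
    RNNCell.state ⟨Matrix.single i₀ i₀ η, Matrix.single i₀ j δ, fun _ => θ⟩ σ x t i₀ =
      scalarState σ η δ θ (zeroExtend fun s => x s j) t := by
  induction t with
  | zero => rfl
  | succ t ih =>
    have h : t < N := ht
    simp [RNNCell.state, scalarState, zeroExtend, h, ih h.le, Matrix.single_mulVec]

theorem approximable_scalarRecurrence (hσ : Continuous σ) (η δ θ ρ : ℝ) (i₀ j : Fin d) :
    Approximable (N := N) σ 1 fun z t =>
      scalarRecurrence σ η δ θ ρ (fun s => z s j) t • Pi.single i₀ (1 : ℝ) := by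
  refine (BRNNCell.approximable hσ
    ⟨⟨Matrix.single i₀ i₀ η, Matrix.single i₀ j δ, fun _ => θ⟩,
      ⟨Matrix.single i₀ i₀ η, Matrix.single i₀ j δ, fun _ => θ⟩,
      Matrix.single i₀ i₀ 1, Matrix.single i₀ i₀ ρ⟩).congr fun z => ?_
  funext t i
  simp only [BRNNCell.apply, RNNCell.forward, RNNCell.backward, Pi.add_apply,
    Matrix.single_mulVec, Pi.smul_apply]
  rw [state_single_apply _ _ _ _ _ _ t.2, state_single_apply _ _ _ _ _ _ t.rev.2]
  by_cases hi : i = i₀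
  · subst hi; simp [scalarRecurrence]
  · simp [hi]

/-- All arguments of `σ` stay in the ball where it is injective. The recurrent term is at most `η *
M`, too small to bridge the gap between two letters, so equal states have equal last letters and
hence equal previous states. As `σ` has no zero on the ball, only the initial state is `0`, so the
lengths agree as well. -/
theorem scalarState_injective {η δ θ r M : ℝ} {T : Set ℝ} (hη : 0 < η) (hδ : 0 < δ)
    (hinj : Set.InjOn σ (Metric.closedBall θ r)) (hM : ∀ y ∈ Metric.closedBall θ r, |σ y| ≤ M)
    (hne : ∀ y ∈ Metric.closedBall θ r, σ y ≠ 0) (hT : ∀ b ∈ T, |δ * b| ≤ r / 2)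
    (hηM : η * M ≤ r / 2) (hM0 : 0 ≤ M)
    (hgap : ∀ b ∈ T, ∀ b' ∈ T, b ≠ b' → 2 * η * M < δ * |b - b'|) (t t' : ℕ) (b b' : ℕ → ℝ)
    (hb : ∀ s < t, b s ∈ T) (hb' : ∀ s < t', b' s ∈ T)
    (h : scalarState σ η δ θ b t = scalarState σ η δ θ b' t') :
    t = t' ∧ ∀ s < t, b s = b' s := by
  have harg : ∀ S β : ℝ, |S| ≤ M → β ∈ T → η * S + δ * β + θ ∈ Metric.closedBall θ r := by
    intro S β hS hβ
    rw [Metric.mem_closedBall, Real.dist_eq, add_sub_cancel_right]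
    calc |η * S + δ * β| ≤ |η * S| + |δ * β| := abs_add_le _ _
      _ ≤ η * M + r / 2 := by
        rw [abs_mul, abs_of_pos hη]
        gcongr
        exact hT β hβ
      _ ≤ r := by linarith
  have hbd : ∀ (c : ℕ → ℝ) (k : ℕ), (∀ s < k, c s ∈ T) → |scalarState σ η δ θ c k| ≤ M := by
    intro c k
    induction k with
    | zero => intro _; simpa [scalarState] using hM0
    | succ k ih =>
      intro hc
      exact hM _ (harg _ _ (ih fun s hs => hc s (by omega)) (hc k (by omega)))
  induction t generalizing t' with
  | zero =>
    cases t' with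
    | zero => simp
    | succ k =>
      exact absurd h.symm (hne _ (harg _ _ (hbd b' k fun s hs => hb' s (by omega))
        (hb' k (by omega))))
  | succ t ih =>
    cases t' with
    | zero =>
      exact absurd h (hne _ (harg _ _ (hbd b t fun s hs => hb s (by omega)) (hb t (by omega))))
    | succ k =>
      have hS := hbd b t fun s hs => hb s (by omega)
      have hS' := hbd b' k fun s hs => hb' s (by omega)
      have h1 := hinj (harg _ _ hS (hb t (by omega))) (harg _ _ hS' (hb' k (by omega))) h
      have h2 : b t = b' k := by
        by_contra hbb
        have h3 := hgap _ (hb t (by omega)) _ (hb' k (by omega)) hbb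
        have h4 : δ * (b t - b' k) =
            η * (scalarState σ η δ θ b' k - scalarState σ η δ θ b t) := by linarith
        have h5 : δ * |b t - b' k| ≤ η * (M + M) := by
          rw [← abs_of_pos hδ, ← abs_mul, h4, abs_mul, abs_of_pos hη]
          gcongr
          exact (abs_sub _ _).trans (add_le_add hS' hS)
        linarith
      have h6 : scalarState σ η δ θ b t = scalarState σ η δ θ b' k := by
        rw [h2] at h1
        exact mul_left_cancel₀ hη.ne' (by linarith)
      obtain ⟨rfl, h7⟩ := ih k (fun s hs => hb s (by omega)) (fun s hs => hb' s (by omega)) h6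
      refine ⟨rfl, fun s hs => ?_⟩
      rcases (Nat.lt_succ_iff_lt_or_eq.1 hs) with hs | rfl
      · exact h7 s hs
      · exact h2

theorem exists_scalarState_injective {θ r : ℝ} (hσ : Continuous σ) (hr : 0 < r)
    (hinj : Set.InjOn σ (Metric.closedBall θ r)) (h0 : σ θ ≠ 0) (T : Finset ℝ) :
    ∃ η δ : ℝ, 0 < η ∧ 0 < δ ∧ ∀ (t t' : ℕ) (b b' : ℕ → ℝ),
      (∀ s < t, b s ∈ T) → (∀ s < t', b' s ∈ T) →
      scalarState σ η δ θ b t = scalarState σ η δ θ b' t' → t = t' ∧ ∀ s < t, b s = b' s := by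
  have hlim : ∀ f : ℝ → ℝ, Continuous f → f 0 = 0 → Tendsto f (𝓝[>] 0) (𝓝 0) :=
    fun f hf h => (h ▸ hf.tendsto 0).mono_left nhdsWithin_le_nhds
  have hev : ∀ᶠ y in 𝓝 θ, |σ y| < |σ θ| + 1 ∧ σ y ≠ 0 :=
    ((hσ.abs.tendsto θ).eventually_lt_const (lt_add_one _)).and
      ((hσ.tendsto θ).eventually_ne h0)
  obtain ⟨r', hr', hb⟩ := Metric.nhds_basis_closedBall.eventually_iff.1 hev
  set M := |σ θ| + 1
  have hM0 : 0 < M := by positivity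
  set q := min r r'
  have hq : 0 < q := lt_min hr hr'
  have hδ : ∀ᶠ δ in 𝓝[>] (0 : ℝ), ∀ b ∈ T, |δ * b| < q / 2 := by
    rw [Filter.eventually_all_finset]
    intro b _
    exact (hlim (fun δ => |δ * b|) (by fun_prop) (by simp)).eventually_lt_const (by positivity)
  -- `δ` is fixed before `η`, which must be small compared with the letter gaps scaled by `δ`.
  obtain ⟨δ, hδT, hδ0⟩ := (hδ.and self_mem_nhdsWithin).exists
  have hη : ∀ᶠ η in 𝓝[>] (0 : ℝ), η * M < q / 2 ∧
      ∀ p ∈ T.offDiag, 2 * η * M < δ * |p.1 - p.2| := by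
    rw [eventually_and, Filter.eventually_all_finset]
    constructor
    · exact (hlim (fun η => η * M) (by fun_prop) (by simp)).eventually_lt_const (by positivity)
    · intro p hp
      have hp' : 0 < |p.1 - p.2| := abs_pos.2 (sub_ne_zero.2 (Finset.mem_offDiag.1 hp).2.2)
      exact (hlim (fun η => 2 * η * M) (by fun_prop) (by simp)).eventually_lt_const
        (mul_pos hδ0 hp')
  obtain ⟨η, ⟨hηM, hgap⟩, hη0⟩ := (hη.and self_mem_nhdsWithin).exists
  refine ⟨η, δ, hη0, hδ0, fun t t' b b' hbT hbT' h => ?_⟩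
  exact scalarState_injective (T := T) hη0 hδ0
    (hinj.mono (Metric.closedBall_subset_closedBall (min_le_left r r')))
    (fun y hy => (hb (Metric.closedBall_subset_closedBall (min_le_right r r') hy)).1.le)
    (fun y hy => (hb (Metric.closedBall_subset_closedBall (min_le_right r r') hy)).2)
    (fun b hb => (hδT b hb).le) hηM.le hM0.le
    (fun b hb b' hb' hne => hgap (b, b') (Finset.mem_offDiag.2 ⟨hb, hb', hne⟩))
    t t' b b' hbT hbT' h

/-- The values of a suitable pair of recurrences determine position and sequence. -/
theorem exists_scalarRecurrence_injective {θ r : ℝ} (hσ : Continuous σ) (hr : 0 < r)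
    (hinj : Set.InjOn σ (Metric.closedBall θ r)) (h0 : σ θ ≠ 0) (T : Finset ℝ) (N : ℕ) :
    ∃ η δ ρ : ℝ, 0 < η ∧ 0 < δ ∧ 1 ≤ ρ ∧ ∀ (t t' : Fin N) (b b' : Fin N → ℝ),
      (∀ s, b s ∈ T) → (∀ s, b' s ∈ T) →
      scalarRecurrence σ η δ θ ρ b t = scalarRecurrence σ η δ θ ρ b' t' → t = t' ∧ b = b' := by
  obtain ⟨η, δ, hη, hδ, hst⟩ := exists_scalarState_injective hσ hr hinj h0 T
  let pr : Fin N × (Fin N → T) → Fin 2 → ℝ := fun p =>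
    ![scalarState σ η δ θ (zeroExtend fun s => (p.2 s : ℝ)) (p.1 + 1),
      scalarState σ η δ θ (zeroExtend fun s => (p.2 s.rev : ℝ)) (p.1.rev + 1)]
  -- With two entries the weights are `1` and `ρ`, so the forward and backward states can be
  -- recovered from their combination.
  obtain ⟨ρ, hρ, hρi⟩ := exists_injOn_sum_pow_mul (Set.finite_range pr)
  refine ⟨η, δ, ρ, hη, hδ, hρ, fun t t' b b' hb hb' h => ?_⟩
  have h1 : pr (t, fun s => ⟨b s, hb s⟩) = pr (t', fun s => ⟨b' s, hb' s⟩) := by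
    refine hρi (Set.mem_range_self _) (Set.mem_range_self _) ?_
    simpa [pr, scalarRecurrence] using h
  have hz : ∀ (c : Fin N → ℝ), (∀ s, c s ∈ T) → ∀ k ≤ N, ∀ s < k, zeroExtend c s ∈ T := by
    intro c hc k hk s hs
    simpa [zeroExtend, hs.trans_le hk] using hc _
  obtain ⟨h2, h3⟩ := hst _ _ _ _ (hz b hb _ t.2) (hz b' hb' _ t'.2) (congrFun h1 0)
  obtain ⟨-, h4⟩ := hst _ _ _ _ (hz (fun s => b s.rev) (fun s => hb _) _ t.rev.2)
    (hz (fun s => b' s.rev) (fun s => hb' _) _ t'.rev.2) (congrFun h1 1)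
  refine ⟨Fin.ext (by simpa using h2), funext fun s => ?_⟩
  -- The forward state determines the tokens up to `t`, the backward state those from `t` on.
  rcases le_total s t with hs | hs
  · have := h3 s (Nat.lt_succ_of_le hs)
    simpa using this
  · have := h4 s.rev (Nat.lt_succ_of_le (Fin.rev_le_rev.2 hs))
    rw [zeroExtend_fin, zeroExtend_fin] at this
    simpa using this

/-- Continuity of the derivative at `z₀` makes it strict, and the inverse function theorem gives
local injectivity. -/
theorem IsNondegenerate.exists_injOn_closedBall (hσ : IsNondegenerate σ) :
    ∃ θ r : ℝ, 0 < r ∧ Set.InjOn σ (Metric.closedBall θ r) ∧ σ θ ≠ 0 := by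
  obtain ⟨-, -, z₀, h1, h2, h3⟩ := hσ
  have hs : HasStrictDerivAt σ (deriv σ z₀) z₀ :=
    hasStrictDerivAt_of_hasDerivAt_of_continuousAt (h1.mono fun z hz => hz.hasDerivAt) h2
  have hs' := hs.hasStrictFDerivAt_equiv h3
  have hnhds := hs'.toOpenPartialHomeomorph σ |>.open_source.mem_nhds
    hs'.mem_toOpenPartialHomeomorph_source
  obtain ⟨r, hr, hball⟩ := Metric.nhds_basis_closedBall.mem_iff.1 hnhds
  have hinj : Set.InjOn σ (Metric.closedBall z₀ r) :=
    (hs'.toOpenPartialHomeomorph σ).injOn.mono hball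
  by_cases h0 : σ z₀ = 0
  -- If `σ z₀ = 0`, injectivity forces a nonzero value at any other centre in the ball.
  · refine ⟨z₀ + r / 2, r / 2, by positivity, hinj.mono fun y hy => ?_, fun h => ?_⟩
    · rw [Metric.mem_closedBall, Real.dist_eq, abs_le] at hy ⊢
      constructor <;> linarith [hy.1, hy.2]
    · have := hinj (Metric.mem_closedBall_self hr.le) (x₂ := z₀ + r / 2) (by
        rw [Metric.mem_closedBall, Real.dist_eq, add_sub_cancel_left, abs_of_pos (by positivity)]
        linarith) (by rw [h0, h])
      linarith
  · exact ⟨z₀, r, hr, hinj, h0⟩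

theorem continuous_relu : Continuous relu := continuous_id.max continuous_const

theorem relu_of_nonneg {z : ℝ} (h : 0 ≤ z) : relu z = z := max_eq_left h

theorem relu_of_nonpos {z : ℝ} (h : z ≤ 0) : relu z = 0 := max_eq_right h

/-- `relu` dominates its argument, a sum of nonnegative terms, so a letter loses at most a factor
`min 1 η` per step. -/
theorem le_scalarState_relu {η δ : ℝ} (hη : 0 < η) (hδ : 0 < δ) {b : ℕ → ℝ} (hb : ∀ s, 0 ≤ b s)
    (t s : ℕ) (hs : s < t) : min 1 η ^ t * (δ * b s) ≤ scalarState relu η δ 1 b t := by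
  have hm : 0 < min 1 η := lt_min one_pos hη
  have hpos : ∀ t, 0 ≤ scalarState relu η δ 1 b t := by
    intro t
    cases t with
    | zero => exact le_rfl
    | succ t => exact le_max_right _ _
  induction t with
  | zero => omega
  | succ t ih =>
    have h1 : η * scalarState relu η δ 1 b t + δ * b t ≤ scalarState relu η δ 1 b (t + 1) :=
      le_trans (by linarith) (le_max_left _ _)
    have h2 := mul_nonneg hη.le (hpos t)
    have h3 := mul_nonneg hδ.le (hb t)
    rcases Nat.lt_succ_iff_lt_or_eq.1 hs with hs | rfl
    · calc min 1 η ^ (t + 1) * (δ * b s) = min 1 η * (min 1 η ^ t * (δ * b s)) := by ring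
        _ ≤ η * scalarState relu η δ 1 b t :=
          mul_le_mul (min_le_right _ _) (ih hs)
            (mul_nonneg (pow_nonneg hm.le _) (mul_nonneg hδ.le (hb s))) hη.le
        _ ≤ _ := by linarith
    · calc min 1 η ^ (s + 1) * (δ * b s) ≤ 1 * (δ * b s) := by
            gcongr
            exact pow_le_one₀ hm.le (min_le_left _ _)
        _ ≤ _ := by linarith

/-- A large letter reaches later times through the forward state and earlier ones through the
backward state, so it is felt at every `t`. -/
theorem exists_le_scalarRecurrence_relu {η δ ρ : ℝ} (hη : 0 < η) (hδ : 0 < δ) (hρ : 1 ≤ ρ)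
    (Λ : ℝ) (N : ℕ) : ∃ E : ℝ, 0 ≤ E ∧ ∀ b : Fin N → ℝ, (∀ s, 0 ≤ b s) → (∃ s, E ≤ b s) → ∀ t,
      Λ ≤ scalarRecurrence relu η δ 1 ρ b t := by
  have hm : 0 < min 1 η := lt_min one_pos hη
  have hc : 0 < min 1 η ^ N * δ := by positivity
  refine ⟨|Λ| / (min 1 η ^ N * δ), by positivity, fun b hb ⟨s, hs⟩ t => ?_⟩
  have hz : ∀ c : Fin N → ℝ, (∀ s, 0 ≤ c s) → ∀ s, 0 ≤ zeroExtend c s := by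
    intro c hc s
    unfold zeroExtend
    split_ifs with h
    exacts [hc _, le_rfl]
  have hpos : ∀ (c : ℕ → ℝ) (k : ℕ), 0 ≤ scalarState relu η δ 1 c (k + 1) :=
    fun c k => le_max_right _ _
  have hmain : ∀ (c : Fin N → ℝ), (∀ s, 0 ≤ c s) → ∀ (k s : Fin N), s ≤ k →
      |Λ| / (min 1 η ^ N * δ) ≤ c s → |Λ| ≤ scalarState relu η δ 1 (zeroExtend c) (k + 1) := by
    intro c hc' k s hsk hE
    refine le_trans ?_ (le_scalarState_relu hη hδ (hz c hc') (k + 1) s (Nat.lt_succ_of_le hsk))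
    rw [div_le_iff₀ hc] at hE
    rw [zeroExtend_fin]
    calc |Λ| ≤ c s * (min 1 η ^ N * δ) := hE
      _ = min 1 η ^ N * (δ * c s) := by ring
      _ ≤ min 1 η ^ (k.val + 1) * (δ * c s) := by
        have := mul_nonneg hδ.le (hc' s)
        gcongr ?_ * _
        exact pow_le_pow_of_le_one hm.le (min_le_left _ _) k.2
  refine (le_abs_self Λ).trans ?_
  unfold scalarRecurrence
  rcases le_total s t with hst | hst
  · have h1 := hmain b hb t s hst hs
    have h2 := hpos (zeroExtend fun s => b s.rev) t.rev
    nlinarith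
  · have h1 := hmain (fun s => b s.rev) (fun s => hb _) t.rev s.rev (Fin.rev_le_rev.2 hst)
      (by simpa using hs)
    have h2 := hpos (zeroExtend b) t
    have h3 := hpos (zeroExtend fun s => b s.rev) t.rev
    nlinarith

theorem relu_isNondegenerate : IsNondegenerate relu := by
  have hev : relu =ᶠ[𝓝 1] id := by
    filter_upwards [lt_mem_nhds one_pos] with z hz using relu_of_nonneg hz.le
  refine ⟨continuous_relu, ?_, 1, ?_, ?_, ?_⟩
  · rintro ⟨q, hq⟩
    have h0 : q = 0 := Polynomial.eq_zero_of_infinite_isRoot q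
      ((Set.Iic_infinite 0).mono fun z hz => by
        simp [← hq, relu_of_nonpos (Set.mem_Iic.1 hz), Polynomial.IsRoot])
    have := hq 1
    simp [h0, relu] at this
  · filter_upwards [hev.eventually_nhds] with z hz
    exact (differentiableAt_id).congr_of_eventuallyEq hz
  · refine ContinuousAt.congr (f := fun _ => 1) continuousAt_const ?_
    filter_upwards [hev.eventually_nhds] with z hz
    rw [Filter.EventuallyEq.deriv_eq (f := id) hz]; simp
  · rw [hev.deriv_eq]; simp

theorem injOn_relu_closedBall : Set.InjOn relu (Metric.closedBall 1 (1 / 2)) := by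
  have h : ∀ y ∈ Metric.closedBall (1 : ℝ) (1 / 2), relu y = y := by
    intro y hy
    rw [Metric.mem_closedBall, Real.dist_eq, abs_le] at hy
    exact relu_of_nonneg (by linarith [hy.1])
  intro y hy z hz hyz
  rwa [h y hy, h z hz] at hyz

/-- There is an approximable recurrence which separates positions and sequences over a finite
alphabet; for `relu`, moreover, it detects large letters. -/
theorem IsNondegenerate.exists_recurrence (hσ : IsNondegenerate σ) (T : Finset ℝ) (N : ℕ) :
    ∃ U : (Fin N → ℝ) → Fin N → ℝ, Continuous U ∧
      (∀ (d : ℕ) (i₀ j : Fin d),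
        Approximable σ 1 fun z t => U (fun s => z s j) t • Pi.single i₀ (1 : ℝ)) ∧
      (∀ (t t' : Fin N) (b b' : Fin N → ℝ), (∀ s, b s ∈ T) → (∀ s, b' s ∈ T) →
        U b t = U b' t' → t = t' ∧ b = b') ∧
      ∀ Λ : ℝ, ∃ E : ℝ, 0 ≤ E ∧ (σ = relu → ∀ b : Fin N → ℝ, (∀ s, 0 ≤ b s) →
        (∃ s, E ≤ b s) → ∀ t, Λ ≤ U b t) := by
  -- For `relu` the bias must be the `1` of `le_scalarState_relu` instead of one supplied by the
  -- inverse function theorem.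
  by_cases h : σ = relu
  · subst h
    obtain ⟨η, δ, ρ, hη, hδ, hρ, hU⟩ := exists_scalarRecurrence_injective continuous_relu
      (by norm_num) injOn_relu_closedBall (by simp [relu]) T N
    refine ⟨scalarRecurrence relu η δ 1 ρ, continuous_scalarRecurrence continuous_relu _ _ _ _,
      fun d i₀ j => approximable_scalarRecurrence continuous_relu _ _ _ _ _ _, hU, fun Λ => ?_⟩
    obtain ⟨E, hE, h⟩ := exists_le_scalarRecurrence_relu hη hδ hρ Λ N
    exact ⟨E, hE, fun _ => h⟩
  · obtain ⟨θ, r, hr, hinj, h0⟩ := hσ.exists_injOn_closedBall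
    obtain ⟨η, δ, ρ, hη, hδ, hρ, hU⟩ := exists_scalarRecurrence_injective hσ.1 hr hinj h0 T N
    exact ⟨scalarRecurrence σ η δ θ ρ, continuous_scalarRecurrence hσ.1 _ _ _ _,
      fun d i₀ j => approximable_scalarRecurrence hσ.1 _ _ _ _ _ _, hU,
      fun Λ => ⟨0, le_rfl, fun h' => absurd h' h⟩⟩

end Recurrence

/-! ### Decoding a scalar -/

section Decoder

variable {N d : ℕ} {σ : ℝ → ℝ} {i₀ i₁ : Fin d}

theorem exists_continuous_interpolation_eq_zero {ι : Type*} [Finite ι] {u : ι → ℝ}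
    (hu : Function.Injective u) (c : ι → ℝ) {Λ : ℝ} (hΛ : ∀ k, u k < Λ) :
    ∃ g : ℝ → ℝ, Continuous g ∧ (∀ k, g (u k) = c k) ∧ ∀ y, Λ ≤ y → g y = 0 := by
  classical
  have := Fintype.ofFinite ι
  -- The factor `max 0 (Λ - y)` kills the half-line; nodal values are divided beforehand by its
  -- values at the nodes.
  refine ⟨fun y => (Lagrange.interpolate Finset.univ u fun k => c k / (Λ - u k)).eval y *
    max 0 (Λ - y), by fun_prop, fun k => ?_, fun y hy => ?_⟩
  · have h := sub_pos.2 (hΛ k)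
    beta_reduce
    rw [Lagrange.eval_interpolate_at_node _ hu.injOn (Finset.mem_univ k), max_eq_right h.le,
      div_mul_cancel₀ _ h.ne']
  · simp [max_eq_left (sub_nonpos.2 hy)]

/-- A scalar in coordinate `i₀` can be decoded into prescribed vectors at finitely many values,
and into zero from some point on. -/
theorem IsNondegenerate.exists_decoder (hσ : IsNondegenerate σ) (hi : i₀ ≠ i₁)
    (h0 : (i₀ : ℕ) = 0) {ι : Type*} [Finite ι] {u : ι → ℝ} (hu : Function.Injective u)
    (v : ι → Fin d → ℝ) {Λ : ℝ} (hΛ : ∀ k, u k < Λ) :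
    ∃ R : ℝ → Fin d → ℝ, Continuous R ∧ (∀ k, R (u k) = v k) ∧ (∀ y, Λ ≤ y → R y = 0) ∧
      ∀ (n : ℕ) (F : (Fin N → Fin d → ℝ) → Fin N → ℝ),
        Approximable σ n (fun z t => F z t • Pi.single i₀ (1 : ℝ)) →
        Approximable σ 0 fun z t => R (F z t) := by
  classical
  -- Zero is included so that the code `0`, produced beyond `Λ`, decodes to the zero vector.
  have hSf : (insert 0 (Set.range v)).Finite := (Set.finite_range v).insert 0
  obtain ⟨α, -, hα⟩ := exists_injOn_sum_pow_mul hSf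
  set w : (Fin d → ℝ) → ℝ := fun x => ∑ i : Fin d, α ^ (i : ℕ) * x i
  obtain ⟨g, hg, hgu, hgΛ⟩ := exists_continuous_interpolation_eq_zero hu (fun k => w (v k)) hΛ
  let G : Fin d → ℝ → ℝ := fun i y =>
    (Lagrange.interpolate hSf.toFinset w fun x => x i).eval y
  have hG : ∀ i, Continuous (G i) := fun i => by fun_prop
  have hGw : ∀ i, ∀ x ∈ insert 0 (Set.range v), G i (w x) = x i := fun i x hx =>
    Lagrange.eval_interpolate_at_node _ (by simpa using hα) (hSf.mem_toFinset.2 hx)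
  -- Coordinate `i₀` holds the code `w x` while the others receive `x i`. As `i₀` has weight `α ^ 0
  -- = 1`, its own entry is `w x` minus the weighted others: a linear step that needs no extra
  -- coordinate.
  let M : Matrix (Fin d) (Fin d) ℝ := Matrix.of fun i j =>
    if i = i₀ then (if j = i₀ then 1 else -α ^ (j : ℕ)) else if j = i then 1 else 0
  let spread : ℝ → Fin d → ℝ := fun y =>
    y • Pi.single i₀ (1 : ℝ) + ∑ i ∈ Finset.univ.erase i₀, G i y • Pi.single i (1 : ℝ)
  have hspread : Continuous spread := by
    refine (continuous_id.smul continuous_const).add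
      (continuous_finsetSum _ fun i _ => (hG i).smul continuous_const)
  have hsp : ∀ y j, spread y j = if j = i₀ then y else G j y := by
    intro y j
    by_cases hj : j = i₀
    · subst hj
      simp [spread, Finset.sum_apply, Pi.single_apply]
    · simp [spread, Finset.sum_apply, Pi.single_apply, hj]
  have hMs : ∀ x ∈ insert 0 (Set.range v), M *ᵥ spread (w x) = x := by
    intro x hx
    funext i
    simp only [Matrix.mulVec, dotProduct, M, Matrix.of_apply, hsp]
    by_cases hii : i = i₀
    · subst hii
      rw [← Finset.add_sum_erase _ _ (Finset.mem_univ i)]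
      have h1 : ∀ j ∈ Finset.univ.erase i, (if i = i then if j = i then 1 else -α ^ (j : ℕ)
          else if j = i then 1 else 0) * (if j = i then w x else G j (w x)) =
          -(α ^ (j : ℕ) * x j) := by
        intro j hj
        have hj' := Finset.ne_of_mem_erase hj
        simp [hj', hGw j x hx]
      rw [Finset.sum_congr rfl h1, Finset.sum_neg_distrib]
      have h2 : w x = x i + ∑ j ∈ Finset.univ.erase i, α ^ (j : ℕ) * x j := by
        simp only [w]
        rw [← Finset.add_sum_erase _ _ (Finset.mem_univ i), h0, pow_zero, one_mul]
      simp only [if_true]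
      linarith
    · simp only [hii, if_false, ite_mul, one_mul, zero_mul, Finset.sum_ite_eq', Finset.mem_univ,
        if_true, hGw i x hx]
  refine ⟨fun y => M *ᵥ spread (g y), ?_, fun k => ?_, fun y hy => ?_, fun n F hF => ?_⟩
  · exact continuous_const.matrix_mulVec (hspread.comp hg)
  · change M *ᵥ spread (g (u k)) = v k
    rw [hgu]
    exact hMs _ (Set.mem_insert_of_mem _ (Set.mem_range_self k))
  · have h1 : w 0 = 0 := by simp [w]
    change M *ᵥ spread (g y) = 0
    rw [hgΛ y hy, ← h1]
    exact hMs 0 (Set.mem_insert _ _)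
  -- A shear cannot overwrite the coordinate it reads, so `g` is written to `i₁`; `e2` then moves it
  -- to `i₀` and clears the rest.
  · have e1 := hσ.approximable_shear (N := N) hi (a := Pi.single i₀ 1) (v := Pi.single i₁ 1)
      (by simp [hi.symm]) hg
    have e2 := hσ.approximable_linear (N := N) hi (Matrix.single i₀ i₁ 1)
    have e3 := hσ.approximable_sum_shear (N := N) hi (Finset.univ.erase i₀)
      (a := fun _ => Pi.single i₀ 1) (v := fun i => Pi.single i 1) (g := G)
      (fun i _ j hj => by simp [(Finset.ne_of_mem_erase hj).symm]) fun i _ => hG i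
    have e4 := hσ.approximable_linear (N := N) hi M
    refine ((e4.comp (e3.comp (e2.comp (e1.comp hF)))).mono (Nat.zero_le _)).congr fun z => ?_
    funext t
    have e5 : Matrix.single i₀ i₁ 1 *ᵥ shear (Pi.single i₀ 1) (Pi.single i₁ 1) g
        (fun t => F z t • Pi.single i₀ (1 : ℝ)) t = g (F z t) • Pi.single i₀ 1 := by
      funext i
      simp [shear, Matrix.single_mulVec, hi, Pi.single_apply, Function.update_apply]
    simp only [e5]
    simp [spread]

end Decoder

/-! ### Approximation of uniformly continuous maps on a box, up to a pointwise limit -/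

section Box

variable {N d dx : ℕ} {σ : ℝ → ℝ}

/-- A continuous approximation of `s ↦ ⌊M (s / C + 1)⌋`, with a peak of height `E` at `|s| = C`. -/
noncomputable def encoder (M : ℕ) (C E : ℝ) (k : ℕ) (s : ℝ) : ℝ :=
  ⌊(M : ℝ) * (s / C + 1)⌋ + max 0 (1 - (k + 1) * (1 - Int.fract ((M : ℝ) * (s / C + 1)))) +
    E * max 0 (1 + (k + 1) * (|s| - C))

/-- The function of the fractional part that is subtracted from the argument vanishes at both `0`
and `1`, so its periodic extension is continuous. -/
theorem continuous_encoder (M : ℕ) (C E : ℝ) (k : ℕ) : Continuous (encoder M C E k) := by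
  have h1 : Continuous fun y : ℝ =>
      (fun r : ℝ => r - max 0 (1 - ((k : ℝ) + 1) * (1 - r))) (Int.fract y) := by
    refine ContinuousOn.comp_fract''
      (f := fun r : ℝ => r - max 0 (1 - ((k : ℝ) + 1) * (1 - r))) (by fun_prop) ?_
    have : (0 : ℝ) ≤ k := k.cast_nonneg
    simp
  have h2 : Continuous fun s : ℝ => (M : ℝ) * (s / C + 1) := by fun_prop
  have h3 : encoder M C E k = fun s : ℝ => (M : ℝ) * (s / C + 1) -
      (Int.fract ((M : ℝ) * (s / C + 1)) -
        max 0 (1 - ((k : ℝ) + 1) * (1 - Int.fract ((M : ℝ) * (s / C + 1))))) +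
      E * max 0 (1 + (k + 1) * (|s| - C)) := by
    funext s
    rw [encoder, Int.fract]
    ring
  rw [h3]
  exact (h2.sub (h1.comp h2)).add (by fun_prop)

theorem floor_nonneg_of_abs_le {M : ℕ} {C s : ℝ} (hC : 0 < C) (hs : |s| ≤ C) :
    0 ≤ ⌊(M : ℝ) * (s / C + 1)⌋ := by
  have h1 := (le_div_iff₀ hC).2 (by linarith [(abs_le.1 hs).1] : -1 * C ≤ s)
  exact Int.floor_nonneg.2 (mul_nonneg M.cast_nonneg (by linarith))

theorem encoder_nonneg {M : ℕ} {C E : ℝ} (hC : 0 < C) (hE : 0 ≤ E) (k : ℕ) {s : ℝ}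
    (hs : |s| ≤ C) : 0 ≤ encoder M C E k s := by
  have h : (0 : ℝ) ≤ ⌊(M : ℝ) * (s / C + 1)⌋ := by exact_mod_cast floor_nonneg_of_abs_le hC hs
  unfold encoder
  positivity

theorem encoder_le {M : ℕ} {C E : ℝ} (hC : 0 < C) (hE : 0 ≤ E) (k : ℕ) {s : ℝ}
    (hs : |s| ≤ C) : encoder M C E k s ≤ 2 * M + 1 + E := by
  have h1 := (div_le_iff₀ hC).2 (by linarith [(abs_le.1 hs).2] : s ≤ 1 * C)
  have h2 : (⌊(M : ℝ) * (s / C + 1)⌋ : ℝ) ≤ 2 * M :=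
    (Int.floor_le _).trans (by nlinarith [(M.cast_nonneg : (0 : ℝ) ≤ M)])
  have hk : (0 : ℝ) ≤ k + 1 := by positivity
  have h3 : max 0 (1 - ((k : ℝ) + 1) * (1 - Int.fract ((M : ℝ) * (s / C + 1)))) ≤ 1 :=
    max_le zero_le_one (by
      linarith [mul_nonneg hk (sub_nonneg.2 (Int.fract_lt_one ((M : ℝ) * (s / C + 1))).le)])
  have h4 : max 0 (1 + ((k : ℝ) + 1) * (|s| - C)) ≤ 1 :=
    max_le zero_le_one (by linarith [mul_nonneg hk (sub_nonneg.2 hs)])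
  have h5 := mul_le_mul_of_nonneg_left h4 hE
  unfold encoder
  linarith

theorem le_encoder {M : ℕ} {C E : ℝ} (hC : 0 < C) (k : ℕ) {s : ℝ}
    (hs : |s| = C) : E ≤ encoder M C E k s := by
  have h : (0 : ℝ) ≤ ⌊(M : ℝ) * (s / C + 1)⌋ := by exact_mod_cast floor_nonneg_of_abs_le hC hs.le
  unfold encoder
  rw [hs, sub_self, mul_zero, add_zero, max_eq_right zero_le_one, mul_one]
  linarith [le_max_left 0 (1 - ((k : ℝ) + 1) * (1 - Int.fract ((M : ℝ) * (s / C + 1))))]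

/-- Both ramps vanish for large `k` because a fractional part is strictly below `1` and `|s| < C`;
hence no exceptional null set arises. -/
theorem eventually_encoder_eq (M : ℕ) {C : ℝ} (E : ℝ) {s : ℝ} (hs : |s| < C) :
    ∀ᶠ k in atTop, encoder M C E k s = ⌊(M : ℝ) * (s / C + 1)⌋ := by
  have key : ∀ c : ℝ, 0 < c → ∀ᶠ k : ℕ in atTop, 1 ≤ ((k : ℝ) + 1) * c := fun c hc =>
    ((tendsto_atTop_add_const_right _ 1 tendsto_natCast_atTop_atTop).atTop_mul_const hc
      ).eventually_ge_atTop 1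
  filter_upwards [key _ (sub_pos.2 (Int.fract_lt_one ((M : ℝ) * (s / C + 1)))),
    key _ (sub_pos.2 hs)] with k h1 h2
  unfold encoder
  rw [max_eq_left (by linarith), max_eq_left (by linarith), mul_zero, add_zero, add_zero]

/-- The inclusion of `ℝᵐ` into `ℝᵈ`, or the projection of `ℝᵐ` to `ℝᵈ`. -/
def coordMatrix (d m : ℕ) : Matrix (Fin d) (Fin m) ℝ :=
  Matrix.of fun i j => if (i : ℕ) = j then 1 else 0

theorem coordMatrix_mulVec_of_lt {m : ℕ} (x : Fin m → ℝ) (i : Fin d) (h : (i : ℕ) < m) :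
    (coordMatrix d m *ᵥ x) i = x ⟨i, h⟩ := by
  simp only [Matrix.mulVec, dotProduct, coordMatrix, Matrix.of_apply, ite_mul, one_mul, zero_mul]
  rw [Finset.sum_eq_single ⟨i, h⟩] <;> simp +contextual [Fin.ext_iff, eq_comm]

theorem coordMatrix_mulVec_of_le {m : ℕ} (x : Fin m → ℝ) (i : Fin d) (h : m ≤ i) :
    (coordMatrix d m *ᵥ x) i = 0 := by
  simp only [Matrix.mulVec, dotProduct, coordMatrix, Matrix.of_apply, ite_mul, one_mul, zero_mul]
  exact Finset.sum_eq_zero fun j _ => if_neg (by omega)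

/-- The grid point of the cube with index `κ`. -/
noncomputable def gridPoint (M : ℕ) (C : ℝ) (κ : Fin N → Fin dx → Fin (2 * M)) :
    Fin N → Fin dx → ℝ :=
  fun s j => C * ((κ s j : ℝ) / M - 1)

theorem exists_grid_index {M : ℕ} (hM : 0 < M) {C : ℝ} (hC : 0 < C) {x : Fin N → Fin dx → ℝ}
    (hx : ∀ s j, |x s j| < C) : ∃ κ : Fin N → Fin dx → Fin (2 * M),
      (∀ s j, (⌊(M : ℝ) * (x s j / C + 1)⌋ : ℝ) = (κ s j : ℕ)) ∧
      dist (gridPoint M C κ) x ≤ C / M := by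
  have hM' : (0 : ℝ) < M := by exact_mod_cast hM
  have h1 : ∀ s j, ∃ n : Fin (2 * M), ⌊(M : ℝ) * (x s j / C + 1)⌋ = ((n : ℕ) : ℤ) := by
    intro s j
    have h2 := floor_nonneg_of_abs_le (M := M) hC (hx s j).le
    have h3 := (div_lt_iff₀ hC).2 (by linarith [(abs_lt.1 (hx s j)).2] : x s j < 1 * C)
    have h4 : ⌊(M : ℝ) * (x s j / C + 1)⌋ < (2 * M : ℕ) := by
      rw [Int.floor_lt]
      push_cast
      nlinarith
    lift ⌊(M : ℝ) * (x s j / C + 1)⌋ to ℕ using h2 with n hn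
    exact ⟨⟨n, by exact_mod_cast h4⟩, rfl⟩
  choose κ hκ using h1
  refine ⟨κ, fun s j => by rw [hκ]; simp, ?_⟩
  refine (dist_pi_le_iff (by positivity)).2 fun s => (dist_pi_le_iff (by positivity)).2 fun j => ?_
  have h2 : ((κ s j : ℕ) : ℝ) = (M : ℝ) * (x s j / C + 1) - Int.fract ((M : ℝ) * (x s j / C + 1)) := by
    rw [Int.self_sub_fract, hκ]; simp
  have h3 : gridPoint M C κ s j - x s j =
      -(C / M * Int.fract ((M : ℝ) * (x s j / C + 1))) := by
    rw [gridPoint, h2]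
    field_simp
    ring
  rw [Real.dist_eq, h3, abs_neg, abs_of_nonneg (mul_nonneg (by positivity) (Int.fract_nonneg _))]
  exact mul_le_of_le_one_right (by positivity) (Int.fract_lt_one _).le

/-- `F k` encodes, runs the recurrence and decodes. At an interior point the codes are eventually
exact, so the output is `G` at a grid point close to `x`. -/
theorem IsNondegenerate.exists_approximable_seq (hσ : IsNondegenerate σ) (h0 : 0 < dx)
    (hd : dx < d) {G : (Fin N → Fin dx → ℝ) → Fin N → Fin d → ℝ} (hG : UniformContinuous G)
    {C η : ℝ} (hC : 0 < C) (hη : 0 < η) :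
    ∃ (F : ℕ → (Fin N → Fin d → ℝ) → Fin N → Fin d → ℝ) (B : ℝ),
      (∀ k, Approximable σ 0 (F k)) ∧
      (∀ (k : ℕ) (x : Fin N → Fin dx → ℝ), (∀ s j, |x s j| ≤ C) → ‖F k fun t => coordMatrix d dx *ᵥ x t‖ ≤ B) ∧
      (∀ x : Fin N → Fin dx → ℝ, (∀ s j, |x s j| < C) →
        ∀ᶠ k in atTop, dist (F k fun t => coordMatrix d dx *ᵥ x t) (G x) ≤ η) ∧
      (σ = relu → ∀ (k : ℕ) (x : Fin N → Fin dx → ℝ), (∀ s j, |x s j| ≤ C) → (∃ s j, |x s j| = C) →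
        (F k fun t => coordMatrix d dx *ᵥ x t) = 0) := by
  classical
  obtain ⟨r, hr, hGr⟩ := Metric.uniformContinuous_iff_le.1 hG η hη
  obtain ⟨M, hM⟩ := exists_nat_gt (C / r)
  have hM' : (0 : ℝ) < M := (div_pos hC hr).trans hM
  have hM0 : 0 < M := by exact_mod_cast hM'
  have hMr : C / M ≤ r := by
    rw [div_lt_iff₀ hr] at hM
    rw [div_le_iff₀ hM']
    linarith
  let dig : (Fin dx → Fin (2 * M)) → Fin dx → ℝ := fun κ j => ((κ j : ℕ) : ℝ)
  have hdig : Function.Injective dig := fun κ κ' h =>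
    funext fun j => Fin.ext (by simpa [dig] using congrFun h j)
  obtain ⟨α, hα1, hα⟩ := exists_injOn_sum_pow_mul (Set.finite_range dig)
  let code : (Fin dx → ℝ) → ℝ := fun y => ∑ j : Fin dx, α ^ (j : ℕ) * y j
  let T : Finset ℝ := Finset.univ.image fun κ => code (dig κ)
  obtain ⟨U, hUc, hUa, hUi, hUE⟩ := hσ.exists_recurrence T N
  let u : Fin N × (Fin N → Fin dx → Fin (2 * M)) → ℝ := fun p => U (fun s => code (dig (p.2 s))) p.1
  have hu : Function.Injective u := by
    rintro ⟨t, κ⟩ ⟨t', κ'⟩ h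
    have hT : ∀ κ : Fin dx → Fin (2 * M), code (dig κ) ∈ T := fun κ =>
      Finset.mem_image_of_mem _ (Finset.mem_univ κ)
    obtain ⟨h1, h2⟩ := hUi t t' _ _ (fun s => hT _) (fun s => hT _) h
    have h3 : κ = κ' := funext fun s => hdig
      (hα (Set.mem_range_self _) (Set.mem_range_self _) (congrFun h2 s))
    rw [h1, h3]
  obtain ⟨Λ₀, hΛ₀⟩ := (Set.finite_range u).bddAbove
  have hΛ : ∀ k, u k < Λ₀ + 1 := fun k =>
    (hΛ₀ (Set.mem_range_self k)).trans_lt (lt_add_one _)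
  -- The peak height comes after the recurrence and the bound on its values at exact codes. There is
  -- no circularity, as the alphabet `T` does not involve `E`.
  obtain ⟨E, hE, hUE⟩ := hUE (Λ₀ + 1)
  have hd0 : 0 < d := by omega
  let i₀ : Fin d := ⟨0, hd0⟩
  let i₁ : Fin d := ⟨1, by omega⟩
  -- The spare coordinate, zero on embedded inputs, where the code is accumulated.
  let l : Fin d := ⟨dx, hd⟩
  have hi : i₀ ≠ i₁ := by simp [i₀, i₁]
  obtain ⟨R, hRc, hRu, hR0, hRa⟩ := hσ.exists_decoder (N := N) hi rfl hu
    (fun p => G (gridPoint M C p.2) p.1) hΛ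
  let b : ℕ → (Fin N → Fin dx → ℝ) → Fin N → ℝ := fun k x s => code fun j => encoder M C E k (x s j)
  let c : Fin dx → Fin d := Fin.castLE hd.le
  have hcl : ∀ j, c j ≠ l := fun j h => by
    have h1 : (j : ℕ) = dx := congrArg Fin.val h
    exact absurd j.2 (by omega)
  let F : ℕ → (Fin N → Fin d → ℝ) → Fin N → Fin d → ℝ := fun k z t =>
    R (U (fun s => z s l + ∑ j : Fin dx, α ^ (j : ℕ) * encoder M C E k (z s (c j))) t)
  have hF : ∀ k x, (F k fun t => coordMatrix d dx *ᵥ x t) = fun t => R (U (b k x) t) := by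
    intro k x
    have h1 : ∀ s, (coordMatrix d dx *ᵥ x s) l = 0 := fun s =>
      coordMatrix_mulVec_of_le _ _ le_rfl
    have h2 : ∀ s j, (coordMatrix d dx *ᵥ x s) (c j) = x s j := fun s j =>
      coordMatrix_mulVec_of_lt _ _ j.2
    simp only [F, h1, h2, zero_add]
    rfl
  have hb0 : ∀ k x, (∀ s j, |x s j| ≤ C) → ∀ s, 0 ≤ b k x s := fun k x hx s =>
    Finset.sum_nonneg fun j _ => mul_nonneg (by positivity) (encoder_nonneg hC hE k (hx s j))
  -- Codes lie in a compact box independent of `k`, which yields the uniform bound.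
  obtain ⟨B, hB⟩ := ((isCompact_univ_pi fun _ : Fin N => isCompact_Icc
    (a := (0 : ℝ)) (b := code fun _ => 2 * M + 1 + E)).image
      (f := fun b' t => R (U b' t)) (by fun_prop)).isBounded.exists_norm_le
  refine ⟨F, B, fun k => ?_, fun k x hx => ?_, fun x hx => ?_, fun hrelu k x hx hxC => ?_⟩
  · have e1 := hσ.approximable_sum_shear (N := N) hi Finset.univ
      (a := fun j => Pi.single (c j) 1) (v := fun _ => Pi.single l 1)
      (g := fun j s => α ^ (j : ℕ) * encoder M C E k s)
      (fun j _ _ _ => by simp [hcl j])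
      fun j _ => continuous_const.mul (continuous_encoder M C E k)
    refine (hRa _ _ ((hUa d i₀ l).comp e1)).congr fun z => ?_
    simp [F, Finset.sum_apply]
  · rw [hF]
    refine hB _ (Set.mem_image_of_mem (fun b' t => R (U b' t)) fun s _ => ⟨hb0 k x hx s, ?_⟩)
    exact Finset.sum_le_sum fun j _ => mul_le_mul_of_nonneg_left
      (encoder_le hC hE k (hx s j)) (by positivity)
  · obtain ⟨κ, hκ, hκd⟩ := exists_grid_index hM0 hC hx
    have hev : ∀ᶠ k in atTop, ∀ s j, encoder M C E k (x s j) = dig (κ s) j := by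
      simp only [eventually_all]
      intro s j
      filter_upwards [eventually_encoder_eq M E (hx s j)] with k hk
      rw [hk, hκ]
    filter_upwards [hev] with k hk
    have h1 : (F k fun t => coordMatrix d dx *ᵥ x t) = G (gridPoint M C κ) := by
      rw [hF]
      funext t
      simp only [b, hk]
      exact hRu (t, κ)
    rw [h1]
    exact hGr (hκd.trans hMr)
  · obtain ⟨s, j, hsj⟩ := hxC
    rw [hF]
    funext t
    refine hR0 _ (hUE hrelu _ (hb0 k x hx) ⟨s, ?_⟩ t)
    calc E ≤ encoder M C E k (x s j) := le_encoder hC k hsj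
      _ ≤ α ^ (j : ℕ) * encoder M C E k (x s j) :=
        le_mul_of_one_le_left (encoder_nonneg hC hE k (hx s j)) (one_le_pow₀ hα1)
      _ ≤ b k x s := Finset.single_le_sum
        (f := fun j : Fin dx => α ^ (j : ℕ) * encoder M C E k (x s j))
        (fun j _ => mul_nonneg (by positivity) (encoder_nonneg hC hE k (hx s j)))
        (Finset.mem_univ j)

end Box

/-! ### Clipping and soft thresholding with `relu` -/

section ReluCells

variable {N d dx : ℕ}

theorem relu_add_sub_relu_sub {C : ℝ} (hC : 0 ≤ C) (s : ℝ) :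
    relu (s + C) - C - relu (s - C) = max (-C) (min C s) := by
  unfold relu
  rcases le_total s (-C) with h | h
  · rw [max_eq_right (by linarith), max_eq_right (by linarith), min_eq_right (by linarith),
      max_eq_left h]
    ring
  · rcases le_total s C with h' | h'
    · rw [max_eq_left (by linarith), max_eq_right (by linarith), min_eq_right h', max_eq_right h]
      ring
    · rw [max_eq_left (by linarith), max_eq_left (by linarith), min_eq_left h',
        max_eq_right (by linarith)]
      ring

theorem exists_clip_cell (hd : dx < d) {C : ℝ} (hC : 0 ≤ C) :
    ∃ c : BRNNCell d, ∀ x : Fin N → Fin dx → ℝ,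
      c.apply relu (fun t => coordMatrix d dx *ᵥ x t) =
        fun t => coordMatrix d dx *ᵥ fun j => max (-C) (min C (x t j)) := by
  let l : Fin d := ⟨dx, hd⟩
  -- The constant `C` in the clipping formula is the forward output of the spare coordinate `l`,
  -- whose input is zero.
  refine ⟨⟨⟨0, 1, fun _ => C⟩, ⟨0, 1, fun _ => -C⟩,
    Matrix.of fun i => if (i : ℕ) < dx then Pi.single i 1 - Pi.single l 1 else 0,
    Matrix.of fun i => if (i : ℕ) < dx then -Pi.single i 1 else 0⟩, fun x => ?_⟩
  have hrow : ∀ (f : Fin d → Fin d → ℝ) (y : Fin d → ℝ) (i : Fin d),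
      (Matrix.of f *ᵥ y) i = f i ⬝ᵥ y := fun _ _ _ => rfl
  rw [BRNNCell.apply_of_A_eq_zero]
  funext t i
  rw [Pi.add_apply, hrow, hrow]
  by_cases hi : (i : ℕ) < dx
  · have h1 : (coordMatrix d dx *ᵥ x t) l = 0 := coordMatrix_mulVec_of_le _ _ le_rfl
    rw [coordMatrix_mulVec_of_lt _ _ hi, ← relu_add_sub_relu_sub hC]
    simp only [hi, if_true, sub_dotProduct, neg_dotProduct, single_one_dotProduct,
      Matrix.one_mulVec, h1, zero_add, relu_of_nonneg hC, coordMatrix_mulVec_of_lt _ _ hi]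
    simp only [sub_eq_add_neg]
  · rw [coordMatrix_mulVec_of_le _ _ (not_lt.1 hi)]
    simp [hi]

/-- Small values off a box are not enough for an `Lᵖ` bound on the whole space; this cell makes them
exactly zero at a uniform cost `η`. -/
theorem exists_soft_threshold_cell {η : ℝ} (hη : 0 ≤ η) :
    ∃ c : BRNNCell d, ∀ z : Fin N → Fin d → ℝ,
      dist (c.apply relu z) z ≤ η ∧ (‖z‖ ≤ η → c.apply relu z = 0) := by
  refine ⟨⟨⟨0, 1, fun _ => -η⟩, ⟨0, -1, fun _ => -η⟩, 1, -1⟩, fun z => ?_⟩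
  have h : ∀ t i, BRNNCell.apply ⟨⟨0, 1, fun _ => -η⟩, ⟨0, -1, fun _ => -η⟩, 1, -1⟩ relu z t i =
      relu (z t i - η) - relu (-z t i - η) := by
    intro t i
    rw [BRNNCell.apply_of_A_eq_zero]
    simp [Matrix.neg_mulVec, sub_eq_add_neg]
  refine ⟨(dist_pi_le_iff hη).2 fun t => (dist_pi_le_iff hη).2 fun i => ?_, fun hz => ?_⟩
  · rw [h, Real.dist_eq, abs_le]
    unfold relu
    rcases max_cases (z t i - η) 0 with h1 | h1 <;>
      rcases max_cases (-z t i - η) 0 with h2 | h2 <;> constructor <;> linarith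
  · funext t i
    have h1 := abs_le.1 (((norm_le_pi_norm (z t) i).trans (norm_le_pi_norm z t)).trans hz)
    rw [h, relu_of_nonpos (by linarith [h1.2]), relu_of_nonpos (by linarith [h1.1])]
    simp

end ReluCells

/-! ### Approximation in `Lᵖ` -/

section Lp

theorem tendsto_eLpNorm_zero_of_bounded {X : Type*} [MeasurableSpace X] {μ : Measure X}
    [IsFiniteMeasure μ] {p : ℝ≥0∞} (hp : 1 ≤ p) (hp' : p ≠ ∞) {h : ℕ → X → ℝ} {B : ℝ}
    (hm : ∀ k, Measurable (h k)) (hB : ∀ k, ∀ᵐ x ∂μ, ‖h k x‖ ≤ B)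
    (hlim : ∀ᵐ x ∂μ, ∀ᶠ k in atTop, h k x = 0) :
    Tendsto (fun k => eLpNorm (h k) p μ) atTop (𝓝 0) := by
  have hp0 : p ≠ 0 := (zero_lt_one.trans_le hp).ne'
  have hpr : 0 < p.toReal := ENNReal.toReal_pos hp0 hp'
  have h1 : Tendsto (fun k => ∫⁻ x, ‖h k x‖ₑ ^ p.toReal ∂μ) atTop (𝓝 (∫⁻ _, 0 ∂μ)) := by
    refine tendsto_lintegral_of_dominated_convergence (fun _ => ENNReal.ofReal B ^ p.toReal)
      (fun k => (hm k).enorm.pow_const _) (fun k => ?_) ?_ ?_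
    · filter_upwards [hB k] with x hx
      gcongr
      rw [← ofReal_norm]
      exact ENNReal.ofReal_le_ofReal hx
    · rw [lintegral_const]
      exact ENNReal.mul_ne_top (ENNReal.rpow_ne_top_of_nonneg hpr.le ENNReal.ofReal_ne_top)
        (measure_ne_top _ _)
    · filter_upwards [hlim] with x hx
      refine tendsto_const_nhds.congr' ?_
      filter_upwards [hx] with k hk
      simp [hk, hpr]
  have h2 := h1.ennrpow_const (1 / p.toReal)
  simp only [lintegral_zero] at h2
  rw [ENNReal.zero_rpow_of_pos (by positivity)] at h2
  simpa only [eLpNorm_eq_lintegral_rpow_enorm_toReal hp0 hp'] using h2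

/-- Maps which are eventually close at each point of a set of finite measure yield maps which are
close in `Lᵖ`. -/
theorem exists_eLpNorm_sub_le {X Y : Type*} [TopologicalSpace X] [MeasurableSpace X]
    [OpensMeasurableSpace X] [NormedAddCommGroup Y] {μ : Measure X} {S : Set X}
    (hS : MeasurableSet S) (hμ : μ S ≠ ∞) {p : ℝ≥0∞} (hp : 1 ≤ p) (hp' : p ≠ ∞)
    {ε : ℝ≥0∞} (hε : ε ≠ 0) :
    ∃ η : ℝ, 0 < η ∧ ∀ (Φ : ℕ → X → Y) (g : X → Y) (B : ℝ), (∀ k, Continuous (Φ k)) →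
      Continuous g → (∀ k, ∀ x ∈ S, ‖Φ k x - g x‖ ≤ B) →
      (∀ x ∈ S, ∀ᶠ k in atTop, dist (Φ k x) (g x) ≤ η) →
      ∃ k, ∀ Ψ : X → Y, (∀ x ∈ S, dist (Ψ x) (Φ k x) ≤ η) →
        eLpNorm (fun x => g x - Ψ x) p (μ.restrict S) ≤ ε := by
  have hfin : IsFiniteMeasure (μ.restrict S) := ⟨by simpa using hμ.lt_top⟩
  have hp0 : p ≠ 0 := (zero_lt_one.trans_le hp).ne'
  have hε2 : 0 < ε / 2 := ENNReal.half_pos hε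
  obtain ⟨η, hη, hηε⟩ : ∃ η : ℝ, 0 < η ∧
      eLpNorm (fun _ : X => 2 * η) p (μ.restrict S) ≤ ε / 2 := by
    set m := (μ.restrict S) Set.univ ^ (1 / p.toReal)
    have hm : m ≠ ∞ := ENNReal.rpow_ne_top_of_nonneg (by positivity) (measure_ne_top _ _)
    have h1 : Tendsto (fun η : ℝ => ENNReal.ofReal (2 * η) * m) (𝓝[>] 0) (𝓝 0) := by
      have h2 : Tendsto (fun η : ℝ => ENNReal.ofReal (2 * η)) (𝓝 0) (𝓝 0) := by
        have : Continuous fun η : ℝ => ENNReal.ofReal (2 * η) :=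
          ENNReal.continuous_ofReal.comp (by fun_prop)
        simpa using this.tendsto 0
      have h3 := ENNReal.Tendsto.mul_const (b := m) h2 (Or.inr hm)
      rw [zero_mul] at h3
      exact h3.mono_left nhdsWithin_le_nhds
    obtain ⟨η, h4, h5⟩ := ((h1.eventually_lt_const hε2).and self_mem_nhdsWithin).exists
    refine ⟨η, h5, le_trans ?_ h4.le⟩
    rw [eLpNorm_const' _ hp0 hp', ← ofReal_norm, Real.norm_of_nonneg]
    exact mul_nonneg zero_le_two (Set.mem_Ioi.1 h5).le
  refine ⟨η, hη, fun Φ g B hΦ hg hB hlim => ?_⟩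
  -- The excess of the error over `η` is eventually zero at each point of `S`, so dominated
  -- convergence applies to it.
  let h : ℕ → X → ℝ := fun k x => max (dist (Φ k x) (g x) - η) 0
  have hc : ∀ k, Continuous (h k) := fun k =>
    (((hΦ k).dist hg).sub continuous_const).max continuous_const
  have ht : Tendsto (fun k => eLpNorm (h k) p (μ.restrict S)) atTop (𝓝 0) := by
    refine tendsto_eLpNorm_zero_of_bounded (B := B) hp hp' (fun k => (hc k).measurable)
      (fun k => ?_) ?_
    · filter_upwards [ae_restrict_mem hS] with x hx
      have h1 := hB k x hx
      rw [← dist_eq_norm] at h1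
      rw [Real.norm_of_nonneg (le_max_right _ _)]
      exact max_le (by linarith) (dist_nonneg.trans h1)
    · filter_upwards [ae_restrict_mem hS] with x hx
      filter_upwards [hlim x hx] with k hk
      exact max_eq_right (sub_nonpos.2 hk)
  obtain ⟨k, hk⟩ := (ht.eventually_lt_const hε2).exists
  refine ⟨k, fun Ψ hΨ => ?_⟩
  calc eLpNorm (fun x => g x - Ψ x) p (μ.restrict S)
      ≤ eLpNorm ((fun _ : X => 2 * η) + h k) p (μ.restrict S) := by
        refine eLpNorm_mono_ae_real ?_
        filter_upwards [ae_restrict_mem hS] with x hx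
        rw [← dist_eq_norm]
        have h1 := dist_triangle_right (g x) (Ψ x) (Φ k x)
        have h2 := hΨ x hx
        have h3 : dist (Φ k x) (g x) - η ≤ h k x := le_max_left _ _
        rw [dist_comm (g x) (Φ k x)] at h1
        simp only [Pi.add_apply]
        linarith
    _ ≤ eLpNorm (fun _ : X => 2 * η) p (μ.restrict S) + eLpNorm (h k) p (μ.restrict S) :=
        eLpNorm_add_le aestronglyMeasurable_const (hc k).measurable.aestronglyMeasurable hp
    _ ≤ ε / 2 + ε / 2 := add_le_add hηε hk.le
    _ = ε := ENNReal.add_halves ε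

end Lp

/-! ### Networks -/

section Networks

variable {N d dx dy : ℕ} {σ : ℝ → ℝ}

/-- The token-wise inclusion or projection, into Euclidean spaces. -/
noncomputable def outputCLM (N d dy : ℕ) :
    (Fin N → Fin d → ℝ) →L[ℝ] (Fin N → EuclideanSpace ℝ (Fin dy)) :=
  LinearMap.toContinuousLinearMap
    { toFun := fun z t => WithLp.toLp 2 (coordMatrix dy d *ᵥ z t)
      map_add' := fun z w => by
        funext t
        simp [Matrix.mulVec_add]
      map_smul' := fun r z => by
        funext t
        simp [Matrix.mulVec_smul] }

/-- The token-wise inclusion or projection, out of Euclidean spaces. -/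
noncomputable def inputCLM (N d dx : ℕ) :
    (Fin N → EuclideanSpace ℝ (Fin dx)) →L[ℝ] (Fin N → Fin d → ℝ) :=
  LinearMap.toContinuousLinearMap
    { toFun := fun x t => coordMatrix d dx *ᵥ (x t).ofLp
      map_add' := fun z w => by
        funext t
        simp [Matrix.mulVec_add]
      map_smul' := fun r z => by
        funext t
        simp [Matrix.mulVec_smul] }

theorem outputCLM_inputCLM (h : dy ≤ d) (y : Fin N → EuclideanSpace ℝ (Fin dy)) :
    outputCLM N d dy (inputCLM N d dy y) = y := by
  funext t
  ext i
  change (coordMatrix dy d *ᵥ (coordMatrix d dy *ᵥ (y t).ofLp)) i = y t i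
  rw [coordMatrix_mulVec_of_lt _ _ (i.2.trans_le h)]
  exact coordMatrix_mulVec_of_lt _ _ i.2

/-- The network with the standard inclusion and projection and a given stack of cells. -/
noncomputable def stackNet (dx dy : ℕ) (l : List (BRNNCell d)) : BRNN dx d dy :=
  ⟨coordMatrix d dx, l, coordMatrix dy d⟩

theorem eval_stackNet (l : List (BRNNCell d)) (x : Fin N → EuclideanSpace ℝ (Fin dx)) :
    (stackNet dx dy l).eval σ x = outputCLM N d dy (runCells σ l (inputCLM N d dx x)) := rfl

theorem continuous_eval_stackNet (hσ : Continuous σ) (l : List (BRNNCell d)) :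
    Continuous fun x : Fin N → EuclideanSpace ℝ (Fin dx) => (stackNet dx dy l).eval σ x :=
  (outputCLM N d dy).continuous.comp
    ((continuous_runCells hσ l).comp (inputCLM N d dx).continuous)

theorem abs_le_norm_seq (x : Fin N → EuclideanSpace ℝ (Fin dx)) (s : Fin N) (j : Fin dx) :
    |x s j| ≤ ‖x‖ :=
  (PiLp.norm_apply_le (x s) j).trans (norm_le_pi_norm x s)

/-- The map computed on inputs from a box, for a continuous target with compact support: networks
come close in `Lᵖ` to it on a set of finite measure inside the open box. -/
theorem IsNondegenerate.exists_seq_euclidean (hσ : IsNondegenerate σ) (h0 : 0 < dx) (hd : dx < d)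
    (hdy : dy ≤ d) {g : (Fin N → EuclideanSpace ℝ (Fin dx)) → Fin N → EuclideanSpace ℝ (Fin dy)}
    (hg : Continuous g) (hgs : HasCompactSupport g) {C η : ℝ} (hC : 0 < C) (hη : 0 < η) :
    ∃ (F : ℕ → (Fin N → Fin d → ℝ) → Fin N → Fin d → ℝ) (B : ℝ),
      (∀ k, Approximable σ 0 (F k)) ∧
      (∀ (k : ℕ) (x : Fin N → EuclideanSpace ℝ (Fin dx)), (∀ s j, |x s j| ≤ C) →
        ‖outputCLM N d dy (F k (inputCLM N d dx x)) - g x‖ ≤ B) ∧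
      (∀ x : Fin N → EuclideanSpace ℝ (Fin dx), (∀ s j, |x s j| < C) →
        ∀ᶠ k in atTop, dist (outputCLM N d dy (F k (inputCLM N d dx x))) (g x) ≤ η) ∧
      (σ = relu → ∀ (k : ℕ) (x : Fin N → EuclideanSpace ℝ (Fin dx)), (∀ s j, |x s j| ≤ C) →
        (∃ s j, |x s j| = C) → F k (inputCLM N d dx x) = 0) := by
  set J := outputCLM N d dy
  have hgu : UniformContinuous g := hgs.uniformContinuous_of_continuous hg
  let ofSeq : (Fin N → Fin dx → ℝ) →L[ℝ] (Fin N → EuclideanSpace ℝ (Fin dx)) := outputCLM N dx dx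
  have hofSeq : ∀ x : Fin N → EuclideanSpace ℝ (Fin dx), ofSeq (fun s => (x s).ofLp) = x := by
    intro x
    funext s
    ext j
    change (coordMatrix dx dx *ᵥ (x s).ofLp) j = x s j
    rw [coordMatrix_mulVec_of_lt _ _ j.2]
  have hG : UniformContinuous fun x => inputCLM N d dy (g (ofSeq x)) :=
    (inputCLM N d dy).uniformContinuous.comp (hgu.comp ofSeq.uniformContinuous)
  have hη' : 0 < η / (‖J‖ + 1) := by positivity
  obtain ⟨F, B, hF, hFB, hFl, hFr⟩ := hσ.exists_approximable_seq h0 hd hG hC hη'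
  obtain ⟨Bg, hBg⟩ := hg.bounded_above_of_compact_support hgs
  refine ⟨F, ‖J‖ * B + Bg, hF, fun k x hx => ?_, fun x hx => ?_, fun h k x => hFr h k fun s => (x s).ofLp⟩
  · refine (norm_sub_le _ _).trans (add_le_add ?_ (hBg x))
    refine (J.le_opNorm _).trans ?_
    gcongr
    exact hFB k (fun s => (x s).ofLp) hx
  · filter_upwards [hFl (fun s => (x s).ofLp) hx] with k hk
    beta_reduce at hk
    rw [hofSeq] at hk
    have h1 := J.lipschitz.dist_le_mul (F k (inputCLM N d dx x)) (inputCLM N d dy (g x))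
    rw [outputCLM_inputCLM hdy] at h1
    calc _ ≤ ‖J‖ * (η / (‖J‖ + 1)) := h1.trans (by
            rw [coe_nnnorm]
            gcongr
            exact hk)
      _ ≤ (‖J‖ + 1) * (η / (‖J‖ + 1)) := by gcongr; linarith
      _ = η := by field_simp

theorem dist_outputCLM_le {z w : Fin N → Fin d → ℝ} {η : ℝ} (hη : 0 ≤ η)
    (h : dist z w ≤ η / (‖outputCLM N d dy‖ + 1)) :
    dist (outputCLM N d dy z) (outputCLM N d dy w) ≤ η := by
  set J := outputCLM N d dy
  calc _ ≤ ‖J‖ * (η / (‖J‖ + 1)) := (J.lipschitz.dist_le_mul _ _).trans (by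
          rw [coe_nnnorm]; gcongr)
    _ ≤ (‖J‖ + 1) * (η / (‖J‖ + 1)) := by gcongr; linarith
    _ = η := by field_simp

theorem IsNondegenerate.exists_net_eLpNorm_le (hσ : IsNondegenerate σ) (h0 : 0 < dx) (hd : dx < d)
    (hdy : dy ≤ d) {g : (Fin N → EuclideanSpace ℝ (Fin dx)) → Fin N → EuclideanSpace ℝ (Fin dy)}
    (hg : Continuous g) (hgs : HasCompactSupport g) {p : ℝ≥0∞} (hp : 1 ≤ p) (hp' : p ≠ ∞)
    {S : Set (Fin N → EuclideanSpace ℝ (Fin dx))} (hS : IsCompact S) {ε : ℝ≥0∞} (hε : ε ≠ 0) :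
    ∃ l : List (BRNNCell d), 2 ≤ l.length ∧
      eLpNorm (fun x => g x - (stackNet dx dy l).eval σ x) p (volume.restrict S) ≤ ε := by
  obtain ⟨η, hη, H⟩ := exists_eLpNorm_sub_le (Y := Fin N → EuclideanSpace ℝ (Fin dy))
    (μ := volume) hS.measurableSet hS.measure_lt_top.ne hp hp' hε
  obtain ⟨C₀, hC₀⟩ := hS.isBounded.exists_norm_le
  set C := max C₀ 0 + 1
  have hC : 0 < C := by positivity
  have hSC : ∀ x ∈ S, ∀ s j, |x s j| < C := fun x hx s j =>
    ((abs_le_norm_seq x s j).trans ((hC₀ x hx).trans (le_max_left _ _))).trans_lt (lt_add_one _)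
  obtain ⟨F, B, hF, hFB, hFl, -⟩ := hσ.exists_seq_euclidean h0 hd hdy hg hgs hC hη
  obtain ⟨k, hk⟩ := H (fun k x => outputCLM N d dy (F k (inputCLM N d dx x))) g B
    (fun k => (outputCLM N d dy).continuous.comp ((hF k).1.comp (inputCLM N d dx).continuous)) hg
    (fun k x hx => hFB k x fun s j => (hSC x hx s j).le) fun x hx => hFl x (hSC x hx)
  have hi : (⟨0, by omega⟩ : Fin d) ≠ ⟨1, by omega⟩ := by simp
  -- Two approximate identities bring the number of cells to at least two.
  have hid := hσ.approximable_id (N := N) hi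
  obtain ⟨l, hl, hlF⟩ := (((hF k).comp hid).comp hid).2 _
    (hS.image (inputCLM N d dx).continuous) (η / (‖outputCLM N d dy‖ + 1)) (by positivity)
  refine ⟨l, hl, hk _ fun x hx => ?_⟩
  rw [eval_stackNet]
  exact dist_outputCLM_le hη.le (hlF _ (Set.mem_image_of_mem _ hx))

theorem exists_relu_net_eLpNorm_le (h0 : 0 < dx) (hd : dx < d)
    (hdy : dy ≤ d) {g : (Fin N → EuclideanSpace ℝ (Fin dx)) → Fin N → EuclideanSpace ℝ (Fin dy)}
    (hg : Continuous g) (hgs : HasCompactSupport g) {p : ℝ≥0∞} (hp : 1 ≤ p) (hp' : p ≠ ∞)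
    {ε : ℝ≥0∞} (hε : ε ≠ 0) :
    ∃ l : List (BRNNCell d), 2 ≤ l.length ∧
      eLpNorm (fun x => g x - (stackNet dx dy l).eval relu x) p volume ≤ ε := by
  obtain ⟨C₀, hC₀⟩ := hgs.isBounded.exists_norm_le
  -- The margin `1` makes `g` vanish already on the boundary of the box.
  set C := max C₀ 0 + 1
  have hC : 0 < C := by positivity
  have hgC : ∀ x, (∃ s j, C ≤ |x s j|) → g x = 0 := by
    rintro x ⟨s, j, hx⟩
    by_contra hne
    have h1 := hC₀ x (subset_tsupport g hne)
    have h2 := abs_le_norm_seq x s j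
    have h3 := le_max_left C₀ 0
    linarith
  set S : Set (Fin N → EuclideanSpace ℝ (Fin dx)) := {x | ∀ s j, |x s j| ≤ C}
  have hS : IsCompact S := by
    have h1 : IsCompact (Set.univ.pi fun _ : Fin N => Set.univ.pi fun _ : Fin dx =>
      Set.Icc (-C) C) := isCompact_univ_pi fun _ => isCompact_univ_pi fun _ => isCompact_Icc
    convert h1.image (outputCLM N dx dx).continuous using 1
    ext x
    constructor
    · intro hx
      refine ⟨fun s => (x s).ofLp, fun s _ j _ => abs_le.1 (hx s j), ?_⟩
      funext s
      ext j
      exact coordMatrix_mulVec_of_lt _ _ j.2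
    · rintro ⟨y, hy, rfl⟩ s j
      have h2 : outputCLM N dx dx y s j = y s j := coordMatrix_mulVec_of_lt _ _ j.2
      rw [h2]
      exact abs_le.2 (hy s trivial j trivial)
  obtain ⟨η, hη, H⟩ := exists_eLpNorm_sub_le (Y := Fin N → EuclideanSpace ℝ (Fin dy))
    (μ := volume) hS.measurableSet hS.measure_lt_top.ne hp hp' hε
  obtain ⟨F, B, hF, hFB, hFl, hFr⟩ := relu_isNondegenerate.exists_seq_euclidean h0 hd hdy hg hgs hC hη
  obtain ⟨k, hk⟩ := H (fun k x => outputCLM N d dy (F k (inputCLM N d dx x))) g B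
    (fun k => (outputCLM N d dy).continuous.comp ((hF k).1.comp (inputCLM N d dx).continuous)) hg
    (fun k x hx => hFB k x hx) fun x hx => by
      -- Encoders converge only in the open box; on its boundary both the target and `F k` are zero.
      by_cases hx' : ∀ s j, |x s j| < C
      · exact hFl x hx'
      · push Not at hx'
        obtain ⟨s, j, hsj⟩ := hx'
        refine Eventually.of_forall fun k => ?_
        rw [hFr rfl k x hx ⟨s, j, le_antisymm (hx s j) hsj⟩, hgC x ⟨s, j, hsj⟩, map_zero, dist_self]
        exact hη.le
  -- One half of the tolerance is for approximating `F k`, the other for the soft threshold.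
  set η' := η / (‖outputCLM N d dy‖ + 1) / 2
  have hη' : 0 < η' := by positivity
  obtain ⟨l, -, hlF⟩ := (hF k).2 _ (hS.image (inputCLM N d dx).continuous) η' hη'
  obtain ⟨c, hc⟩ := exists_clip_cell (N := N) hd hC.le
  obtain ⟨c', hc'⟩ := exists_soft_threshold_cell (N := N) (d := d) hη'.le
  have hrun : ∀ x : Fin N → EuclideanSpace ℝ (Fin dx), runCells relu ([c] ++ l ++ [c'])
      (inputCLM N d dx x) = c'.apply relu (runCells relu l (inputCLM N d dx
        fun s => WithLp.toLp 2 fun j => max (-C) (min C (x s j)))) := by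
    intro x
    rw [runCells_append, runCells_append]
    have h1 : runCells relu [c] (inputCLM N d dx x) = inputCLM N d dx
        fun s => WithLp.toLp 2 fun j => max (-C) (min C (x s j)) := hc fun s => (x s).ofLp
    rw [h1]
    rfl
  refine ⟨[c] ++ l ++ [c'], by simp, ?_⟩
  rw [← eLpNorm_restrict_eq_of_support_subset (s := S)]
  · refine hk _ fun x hx => ?_
    rw [eval_stackNet]
    refine dist_outputCLM_le hη.le ?_
    have h1 : (fun s => WithLp.toLp 2 fun j => max (-C) (min C (x s j))) = x := by
      funext s
      ext j
      have h2 := abs_le.1 (hx s j)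
      simp [min_eq_right h2.2, max_eq_right h2.1]
    rw [hrun, h1]
    calc _ ≤ η' + η' := (dist_triangle _ _ _).trans
            (add_le_add (hc' _).1 (hlF _ (Set.mem_image_of_mem _ hx)))
      _ = _ := add_halves _
  · intro x hx
    by_contra hxS
    refine hx ?_
    have hxS' : ∃ s j, C < |x s j| := by simpa [S] using hxS
    obtain ⟨s, j, hsj⟩ := hxS'
    -- The clipped point has a coordinate of modulus exactly `C`, so `F k` vanishes there and the
    -- threshold removes what the stack leaves.
    set x' : Fin N → EuclideanSpace ℝ (Fin dx) :=
      fun s => WithLp.toLp 2 fun j => max (-C) (min C (x s j))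
    have hx' : x' ∈ S := fun s j => abs_le.2
      ⟨le_max_left _ _, max_le (by linarith) (min_le_left _ _)⟩
    have hx'C : |x' s j| = C := by
      change |max (-C) (min C (x s j))| = C
      rcases lt_abs.1 hsj with h | h
      · rw [min_eq_left h.le, max_eq_right (by linarith), abs_of_pos hC]
      · rw [min_eq_right (by linarith), max_eq_left (by linarith), abs_neg, abs_of_pos hC]
    have h1 := hlF _ (Set.mem_image_of_mem _ hx')
    rw [hFr rfl k x' hx' ⟨s, j, hx'C⟩, dist_zero_right] at h1
    beta_reduce
    rw [hgC x ⟨s, j, hsj.le⟩, eval_stackNet, hrun, (hc' _).2 h1, map_zero, sub_zero]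

theorem iSup_eLpNorm_lt_of_le {X : Type*} [MeasurableSpace X] {μ : Measure X} {p : ℝ≥0∞}
    (hp : 1 ≤ p) {f g Ψ : X → Fin N → EuclideanSpace ℝ (Fin dy)} {ε : ℝ} (hε : 0 < ε)
    (hfg : AEStronglyMeasurable (f - g) μ) (hgΨ : AEStronglyMeasurable (fun x => g x - Ψ x) μ)
    (h1 : eLpNorm (f - g) p μ ≤ ENNReal.ofReal (ε / 4))
    (h2 : eLpNorm (fun x => g x - Ψ x) p μ ≤ ENNReal.ofReal (ε / 4)) :
    (⨆ t : Fin N, eLpNorm (fun x => f x t - Ψ x t) p μ) < ENNReal.ofReal ε := by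
  -- Two errors of `ε / 4` add up to `ε / 2`, which leaves room for the strict inequality.
  refine lt_of_le_of_lt (b := ENNReal.ofReal (ε / 2)) (iSup_le fun t => ?_)
    ((ENNReal.ofReal_lt_ofReal_iff hε).2 (by linarith))
  calc eLpNorm (fun x => f x t - Ψ x t) p μ
      ≤ eLpNorm ((f - g) + fun x => g x - Ψ x) p μ := by
        refine eLpNorm_mono fun x => ?_
        simpa using norm_le_pi_norm (f x - Ψ x) t
    _ ≤ ENNReal.ofReal (ε / 4) + ENNReal.ofReal (ε / 4) :=
        (eLpNorm_add_le hfg hgΨ hp).trans (add_le_add h1 h2)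
    _ = ENNReal.ofReal (ε / 2) := by
        rw [← ENNReal.ofReal_add (by positivity) (by positivity)]
        ring_nf

end Networks

theorem mainTheorem5 (dx dy N : ℕ) (hdx : 0 < dx) (p : ℝ≥0∞) (hp : 1 ≤ p) (hp' : p ≠ ∞)
    (f : (Fin N → EuclideanSpace ℝ (Fin dx)) → (Fin N → EuclideanSpace ℝ (Fin dy)))
    (hf : MemLp f p volume) :
    (∀ σ : ℝ → ℝ, IsNondegenerate σ →
      ∀ ε : ℝ, 0 < ε → ∀ K : Set (EuclideanSpace ℝ (Fin dx)), IsCompact K →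
        ∃ net : BRNN dx (max (dx + 1) dy + 1) dy, net.IsDeep ∧
          (⨆ t : Fin N, eLpNorm (fun x => f x t - net.eval σ x t) p
            (volume.restrict (Set.univ.pi fun _ => K))) < ENNReal.ofReal ε) ∧
    (∀ ε : ℝ, 0 < ε →
      ∃ net : BRNN dx (max (dx + 1) dy) dy, net.IsDeep ∧
        (⨆ t : Fin N, eLpNorm (fun x => f x t - net.eval relu x t) p volume)
          < ENNReal.ofReal ε) := by
  have hreg : (volume : Measure (Fin N → EuclideanSpace ℝ (Fin dx))).Regular :=
    Measure.Regular.of_sigmaCompactSpace_of_isLocallyFiniteMeasure _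
  have key : ∀ ε : ℝ, 0 < ε → ENNReal.ofReal (ε / 4) ≠ 0 := fun ε hε =>
    (ENNReal.ofReal_pos.2 (by positivity)).ne'
  refine ⟨fun σ hσ ε hε K hK => ?_, fun ε hε => ?_⟩
  · obtain ⟨g, hgs, hfg, hg, hgp⟩ := hf.exists_hasCompactSupport_eLpNorm_sub_le hp' (key ε hε)
    obtain ⟨l, hl, hle⟩ := hσ.exists_net_eLpNorm_le (d := max (dx + 1) dy + 1) hdx (by omega)
      (by omega) hg hgs hp hp' (isCompact_univ_pi fun _ : Fin N => hK) (key ε hε)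
    exact ⟨stackNet dx dy l, hl, iSup_eLpNorm_lt_of_le hp hε
      (hf.1.sub hgp.1).restrict (hg.sub (continuous_eval_stackNet hσ.1 l)).aestronglyMeasurable
      ((eLpNorm_restrict_le _ _ _ _).trans hfg) hle⟩
  · obtain ⟨g, hgs, hfg, hg, hgp⟩ := hf.exists_hasCompactSupport_eLpNorm_sub_le hp' (key ε hε)
    obtain ⟨l, hl, hle⟩ := exists_relu_net_eLpNorm_le (d := max (dx + 1) dy) hdx (by omega)
      (by omega) hg hgs hp hp' (key ε hε)
    exact ⟨stackNet dx dy l, hl, iSup_eLpNorm_lt_of_le hp hε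
      (hf.1.sub hgp.1) (hg.sub (continuous_eval_stackNet continuous_relu l)).aestronglyMeasurable
      hfg hle⟩
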